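/- Let $q=p^s$ be a power of a prime $p$, let $\ell\ge 1$, and let $X$ be a smooth projective geometrically irreducible curve over $\mathbf F_{q^\ell}$ with function field $F$ (that is, $F/\mathbf F_{q^\ell}$ is a function field in one variable with full constant field $\mathbf F_{q^\ell}$, and the closed points of $X$ are the places of $F$). For a divisor $A$ on $X$, let $\Omega(A)=H^0(X,\Omega_X\otimes\mathcal O_X(-A))$ be the $\mathbf F_{q^\ell}$-space of rational differential forms $\omega$ with $v_P(\omega)\ge v_P(A)$ at every place $P$, and let $h^1(A)=\dim_{\mathbf F_{q^\ell}}\Omega(A)$, which is finite. The Cartier operator $\mathcal C$ on the rational differential forms of $X$ is defined by $$\mathcal C\big((f_0^p+f_1^p x+\cdots+f_{p-1}^p x^{p-1})\,dx\big)=f_{p-1}\,dx \qquad (f_0,\dots,f_{p-1}\in F),$$ where $x$ is a separating element of $F/\mathbf F_{q^\ell}$ (the result does not depend on $x$); put $\mathcal C_q=\mathcal C^{s}$. Let $P_1,\dots,P_n$ be distinct rational points of $X$, let $D=P_1+\cdots+P_n$, and let $G$ be a divisor on $X$ whose support contains none of the $P_i$. Let $\mathrm{res}_D(\omega)=(\mathrm{res}_{P_1}(\omega),\dots,\mathrm{res}_{P_n}(\omega))$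 and put $$C_\Omega(D,G)=\mathrm{res}_D\big(\Omega(G-D)\big)\subseteq\mathbf F_{q^\ell}^n,\qquad C_\Omega(D,G)_{|\mathbf F_q}=C_\Omega(D,G)\cap\mathbf F_q^n,$$ $$Car_q(D,G)=\mathrm{res}_D\big(\{\omega\in\Omega(G-D) : \mathcal C_q(\omega)=\omega\}\big).$$ Let $G_1$ be a divisor on $X$ such that $G\ge qG_1$ and $G\ge G_1$. Then $Car_q(D,G)$ is an $\mathbf F_q$-subspace of $C_\Omega(D,G)_{|\mathbf F_q}$, and $$\dim_{\mathbf F_q}\Big(C_\Omega(D,G)_{|\mathbf F_q}\big/Car_q(D,G)\Big)\le \ell\, h^1(G_1).$$ In particular, if $h^1(G_1)=0$, then $C_\Omega(D,G)_{|\mathbf F_q}=Car_q(D,G)$. -/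

import Mathlib

open scoped WithZero IntermediateField KaehlerDifferential

namespace AGCode

/-- `F` is the function field of a (smooth projective geometrically irreducible) curve over the
perfect field `K`: it is a finite extension of a rational function field `K(x)`, and `K` is
algebraically closed in `F`. -/
class IsCurveFunctionField (K F : Type*) [Field K] [Field F] [Algebra K F] : Prop where
  exists_finite : ∃ x : F, Transcendental K x ∧ FiniteDimensional K⟮x⟯ F
  algebraic_mem : ∀ y : F, IsAlgebraic K y → ∃ a : K, algebraMap K F a = y

/-- A place of `F / K` (a closed point of the curve), given by its local ring: a discrete
valuation ring of `F` that contains `K`. -/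
structure Place (K F : Type*) [Field K] [Field F] [Algebra K F] where
  localRing : ValuationSubring F
  algebraMap_mem : ∀ a : K, algebraMap K F a ∈ localRing
  isDVR : IsDiscreteValuationRing localRing

attribute [instance] Place.isDVR

/-- Divisors of the curve. -/
abbrev Divisor (K F : Type*) [Field K] [Field F] [Algebra K F] := Place K F →₀ ℤ

section

variable {K F : Type*} [Field K] [Field F] [Algebra K F]

namespace Place

/-- The normalised valuation at `P`, written multiplicatively: its value at `f ≠ 0` is
`WithZero.exp (-v_P(f))`. -/
noncomputable def valuation (P : Place K F) : Valuation F ℤᵐ⁰ :=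
  (IsDiscreteValuationRing.maximalIdeal P.localRing).valuation F

/-- `v_P(f) ≥ m` (true for `f = 0`). -/
def OrdGE (P : Place K F) (m : ℤ) (f : F) : Prop := P.valuation f ≤ WithZero.exp (-m)

/-- `v_P(t) = 1`. -/
def IsUniformizer (P : Place K F) (t : F) : Prop := P.valuation t = WithZero.exp (-1)

/-- The place is rational: the residue field at `P` is `K`. -/
def IsRational (P : Place K F) : Prop :=
  ∀ f ∈ P.localRing, ∃ a : K, P.OrdGE 1 (f - algebraMap K F a)

/-- `v_P(ω) ≥ m` for a rational differential `ω`: writing `ω = f dt` with `t` a uniformiser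
at `P`, one has `v_P(f) ≥ m`. This does not depend on `t`. -/
def DiffOrdGE (P : Place K F) (m : ℤ) (ω : Ω[F⁄K]) : Prop :=
  ∀ t : F, P.IsUniformizer t → ∃ f : F, P.OrdGE m f ∧ ω = f • KaehlerDifferential.D K F t

/-- `res_P(ω) = a` at a rational place `P`: writing `ω = f dt` with `t` a uniformiser at `P`, the
coefficient of `t⁻¹` in the Laurent expansion
`f = c_N t^(-N-1) + ⋯ + c_1 t^(-2) + c_0 t^(-1) + (regular at P)` is `c_0 = a`.
This does not depend on `t`. -/
def HasResidue (P : Place K F) (ω : Ω[F⁄K]) (a : K) : Prop :=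
  ∀ t : F, P.IsUniformizer t → ∃ (N : ℕ) (c : ℕ → K) (r : F), r ∈ P.localRing ∧
    ω = ((∑ i ∈ Finset.range (N + 1), algebraMap K F (c i) * (t ^ (i + 1))⁻¹) + r) •
      KaehlerDifferential.D K F t ∧ c 0 = a

lemma OrdGE.add {P : Place K F} {m : ℤ} {f g : F} (hf : P.OrdGE m f) (hg : P.OrdGE m g) :
    P.OrdGE m (f + g) := Valuation.map_add_le _ hf hg

lemma OrdGE.const_mul {P : Place K F} {m : ℤ} {f : F} (a : K) (hf : P.OrdGE m f) :
    P.OrdGE m (algebraMap K F a * f) := by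
  have h1 : P.valuation (algebraMap K F a) ≤ 1 :=
    (IsDiscreteValuationRing.maximalIdeal P.localRing).valuation_le_one
      (⟨algebraMap K F a, P.algebraMap_mem a⟩ : P.localRing)
  unfold OrdGE at *
  rw [map_mul]
  exact (mul_le_mul' h1 hf).trans_eq (one_mul _)

lemma HasResidue.add {P : Place K F} {ω η : Ω[F⁄K]} {a b : K} (hω : P.HasResidue ω a)
    (hη : P.HasResidue η b) : P.HasResidue (ω + η) (a + b) := by
  have pad : ∀ (t : F) (N M : ℕ) (c : ℕ → K),
      ∑ i ∈ Finset.range (N + M + 1), algebraMap K F (if i < N + 1 then c i else 0) *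
        (t ^ (i + 1))⁻¹ = ∑ i ∈ Finset.range (N + 1), algebraMap K F (c i) * (t ^ (i + 1))⁻¹ := by
    intro t N M c
    rw [← Finset.sum_subset (Finset.range_mono (by omega : N + 1 ≤ N + M + 1))]
    · refine Finset.sum_congr rfl fun i hi => ?_
      rw [if_pos (Finset.mem_range.1 hi)]
    · intro i _ hi
      rw [if_neg (by simpa using hi), map_zero, zero_mul]
  intro t ht
  obtain ⟨N, c, r, hr, h1, h2⟩ := hω t ht
  obtain ⟨M, d, s, hs, h3, h4⟩ := hη t ht
  refine ⟨N + M, fun i => (if i < N + 1 then c i else 0) + (if i < M + 1 then d i else 0), r + s,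
    add_mem hr hs, ?_, by simp [h2, h4]⟩
  have e1 := pad t N M c
  have e2 := pad t M N d
  rw [add_comm M N] at e2
  simp only [map_add, add_mul, Finset.sum_add_distrib]
  rw [e1, e2, h1, h3, ← add_smul]
  congr 1
  ring

lemma HasResidue.zero (P : Place K F) : P.HasResidue 0 0 :=
  fun _ _ => ⟨0, 0, 0, zero_mem _, by simp, rfl⟩

lemma HasResidue.smul {P : Place K F} {ω : Ω[F⁄K]} {a : K} (b : K) (hω : P.HasResidue ω a) :
    P.HasResidue (b • ω) (b * a) := by
  intro t ht
  obtain ⟨N, c, r, hr, h1, h2⟩ := hω t ht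
  refine ⟨N, fun i => b * c i, algebraMap K F b * r, mul_mem (P.algebraMap_mem b) hr, ?_,
    by simp [h2]⟩
  rw [h1, ← smul_assoc, Algebra.smul_def, mul_add, Finset.mul_sum]
  simp only [map_mul, mul_assoc]

end Place

/-- The space `Ω(A) = H⁰(X, Ω_X ⊗ O_X(-A))` of rational differentials `ω` with
`v_P(ω) ≥ A(P)` at every place `P`. -/
def diffSpace (A : Divisor K F) : Submodule K Ω[F⁄K] where
  carrier := {ω | ∀ P : Place K F, P.DiffOrdGE (A P) ω}
  add_mem' := by
    intro ω η hω hη P t ht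
    obtain ⟨f, hf, h1⟩ := hω P t ht
    obtain ⟨g, hg, h2⟩ := hη P t ht
    exact ⟨f + g, hf.add hg, by rw [h1, h2, add_smul]⟩
  zero_mem' := fun P t _ => ⟨0, by simp [Place.OrdGE], by simp⟩
  smul_mem' := by
    intro a ω hω P t ht
    obtain ⟨f, hf, h1⟩ := hω P t ht
    exact ⟨algebraMap K F a * f, hf.const_mul a, by
      rw [h1, ← smul_assoc, Algebra.smul_def]⟩

/-- `h¹(A) = dim_K Ω(A)`. -/
noncomputable def h1 (A : Divisor K F) : ℕ := Module.finrank K (diffSpace A)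

/-- The divisor `D = P_1 + ⋯ + P_n`. -/
noncomputable def pointDivisor {n : ℕ} (P : Fin n → Place K F) : Divisor K F :=
  ∑ i, Finsupp.single (P i) 1

/-- The code `C_Ω(D, G)`: the image of `Ω(G - D)` under `ω ↦ (res_{P_1} ω, …, res_{P_n} ω)`. -/
def residueCode {n : ℕ} (P : Fin n → Place K F) (G : Divisor K F) : Submodule K (Fin n → K) where
  carrier := {c | ∃ ω ∈ diffSpace (G - pointDivisor P), ∀ i, (P i).HasResidue ω (c i)}
  add_mem' := by
    rintro c d ⟨ω, hω, h1⟩ ⟨η, hη, h2⟩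
    exact ⟨ω + η, add_mem hω hη, fun i => (h1 i).add (h2 i)⟩
  zero_mem' := ⟨0, zero_mem _, fun i => Place.HasResidue.zero _⟩
  smul_mem' := by
    rintro a c ⟨ω, hω, h1⟩
    exact ⟨a • ω, Submodule.smul_mem _ a hω, fun i => (h1 i).smul a⟩

/-- The subfield subcode `C ∩ kⁿ`, inside `Kⁿ`, of a code `C` over `K`. -/
def subfieldSubcode (k : Type*) [Field k] [Algebra k K] {n : ℕ} (C : Submodule K (Fin n → K)) :
    Submodule k (Fin n → K) where
  carrier := {c | c ∈ C ∧ ∀ i, c i ∈ (algebraMap k K).range}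
  add_mem' := fun hc hd => ⟨add_mem hc.1 hd.1, fun i => add_mem (hc.2 i) (hd.2 i)⟩
  zero_mem' := ⟨zero_mem _, fun _ => zero_mem _⟩
  smul_mem' := by
    rintro a c ⟨hc, h⟩
    refine ⟨?_, fun i => ?_⟩
    · rw [← algebraMap_smul K a c]
      exact Submodule.smul_mem _ _ hc
    · rw [Pi.smul_apply, Algebra.smul_def]
      exact mul_mem ⟨a, rfl⟩ (h i)

/-- `x` is a separating element of `F / K`. -/
def IsSeparating (K : Type*) {F : Type*} [Field K] [Field F] [Algebra K F] (x : F) : Prop :=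
  Transcendental K x ∧ Algebra.IsSeparable K⟮x⟯ F

/-- The graph of the Cartier operator `𝒞` in characteristic `p`: `𝒞(ω) = η` when, writing
`ω = (f_0^p + f_1^p x + ⋯ + f_{p-1}^p x^{p-1}) dx` with `x` a separating element, one has
`η = f_{p-1} dx`. This does not depend on `x`. -/
def IsCartier (p : ℕ) (ω η : Ω[F⁄K]) : Prop :=
  ∀ x : F, IsSeparating K x → ∃ f : ℕ → F,
    ω = (∑ i ∈ Finset.range p, f i ^ p * x ^ i) • KaehlerDifferential.D K F x ∧
    η = f (p - 1) • KaehlerDifferential.D K F x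

/-- The graph of the `s`-fold iterate of the Cartier operator. -/
def IsCartierIter (p : ℕ) : ℕ → Ω[F⁄K] → Ω[F⁄K] → Prop
  | 0, ω, η => ω = η
  | s + 1, ω, η => ∃ θ, IsCartier p ω θ ∧ IsCartierIter p s θ η

lemma IsCartier.add {p : ℕ} [Fact p.Prime] [CharP F p] {ω ω' η η' : Ω[F⁄K]}
    (h : IsCartier p ω η) (h' : IsCartier p ω' η') : IsCartier p (ω + ω') (η + η') := by
  intro x hx
  obtain ⟨f, h1, h2⟩ := h x hx
  obtain ⟨g, h3, h4⟩ := h' x hx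
  refine ⟨f + g, ?_, ?_⟩
  · rw [h1, h3, ← add_smul, ← Finset.sum_add_distrib]
    simp only [Pi.add_apply, add_pow_char, add_mul]
  · rw [h2, h4, ← add_smul, Pi.add_apply]

lemma IsCartier.smul {p : ℕ} {ω η : Ω[F⁄K]} (b : K) (h : IsCartier p ω η) :
    IsCartier p (b ^ p • ω) (b • η) := by
  intro x hx
  obtain ⟨f, h1, h2⟩ := h x hx
  refine ⟨fun i => algebraMap K F b * f i, ?_, ?_⟩
  · rw [h1, ← smul_assoc, Algebra.smul_def, Finset.mul_sum]
    simp only [map_pow, mul_pow, mul_assoc]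
  · rw [h2, ← smul_assoc, Algebra.smul_def]

lemma IsCartier.zero {p : ℕ} (hp : p ≠ 0) : IsCartier p (0 : Ω[F⁄K]) 0 :=
  fun _ _ => ⟨0, by simp [hp], by simp⟩

lemma IsCartierIter.add {p : ℕ} [Fact p.Prime] [CharP F p] : ∀ {s : ℕ} {ω ω' η η' : Ω[F⁄K]},
    IsCartierIter p s ω η → IsCartierIter p s ω' η' → IsCartierIter p s (ω + ω') (η + η')
  | 0, _, _, _, _, h, h' => congrArg₂ (· + ·) h h'
  | _ + 1, _, _, _, _, ⟨θ, h1, h2⟩, ⟨θ', h3, h4⟩ => ⟨θ + θ', h1.add h3, h2.add h4⟩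

lemma IsCartierIter.smul {p : ℕ} (b : K) : ∀ {s : ℕ} {ω η : Ω[F⁄K]},
    IsCartierIter p s ω η → IsCartierIter p s (b ^ p ^ s • ω) (b • η)
  | 0, ω, η, h => by
    rw [pow_zero, pow_one]
    exact congrArg (b • ·) h
  | s + 1, _, _, ⟨θ, h1, h2⟩ => by
    refine ⟨b ^ p ^ s • θ, ?_, h2.smul b⟩
    rw [pow_succ, pow_mul]
    exact h1.smul _

lemma IsCartierIter.zero {p : ℕ} (hp : p ≠ 0) : ∀ s : ℕ, IsCartierIter p s (0 : Ω[F⁄K]) 0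
  | 0 => rfl
  | s + 1 => ⟨0, IsCartier.zero hp, IsCartierIter.zero hp s⟩

/-- The Cartier code `Car_q(D, G)`, where `q = #k = p ^ s`: the image, in `Kⁿ`, of the space of
all `ω ∈ Ω(G - D)` with `𝒞_q(ω) = ω` under `ω ↦ (res_{P_1} ω, …, res_{P_n} ω)`; here
`𝒞_q = 𝒞 ^ s`. -/
def cartierCode (k : Type*) [Field k] [Algebra k K] [Finite k] {p s : ℕ} [Fact p.Prime]
    [CharP F p] (hq : Nat.card k = p ^ s) {n : ℕ} (P : Fin n → Place K F) (G : Divisor K F) :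
    Submodule k (Fin n → K) where
  carrier := {c | ∃ ω ∈ diffSpace (G - pointDivisor P), IsCartierIter p s ω ω ∧
    ∀ i, (P i).HasResidue ω (c i)}
  add_mem' := by
    rintro c d ⟨ω, hω, h1, h2⟩ ⟨η, hη, h3, h4⟩
    exact ⟨ω + η, add_mem hω hη, h1.add h3, fun i => (h2 i).add (h4 i)⟩
  zero_mem' := ⟨0, zero_mem _, IsCartierIter.zero (Fact.out : p.Prime).ne_zero s,
    fun i => Place.HasResidue.zero _⟩
  smul_mem' := by
    rintro a c ⟨ω, hω, h1, h2⟩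
    refine ⟨algebraMap k K a • ω, Submodule.smul_mem _ _ hω, ?_, fun i => ?_⟩
    · have h := h1.smul (algebraMap k K a)
      have ha : a ^ p ^ s = a := by
        have := Fintype.ofFinite k
        rw [← hq, Nat.card_eq_fintype_card, FiniteField.pow_card]
      rwa [← map_pow, ha] at h
    · rw [Pi.smul_apply, Algebra.smul_def]
      exact (h2 i).smul _

end

end AGCode

/-!
Near a point `P` of `D`, a differential `ω ∈ Ω(G - D)` with residue `a` is `a t⁻¹ dt` plus a regular
differential, and `𝒞_q` maps `a ^ q t⁻¹ dt` to `a t⁻¹ dt` and preserves regular differentials. Hence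
`𝒞_q ω - ω` is regular at `P` exactly when `a ^ q = a`, that is `a ∈ 𝔽_q`. Away from `D`, the
inequalities `G ≥ q G₁` and `G ≥ G₁` bound the poles of `𝒞_q ω` and of `ω` by `G₁`. So `𝒞_q - 1` is
an `𝔽_q`-linear map to `Ω(G₁)` from the space of all `ω ∈ Ω(G - D)` with residues in `𝔽_q`; its
kernel maps onto `Car_q(D, G)` under the residues, and the quotient is therefore no larger than
`Ω(G₁)`, whose dimension over `𝔽_q` is `ℓ h¹(G₁)`.
-/

namespace AGCode

open KaehlerDifferential (D)

section FunctionField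

variable {K F : Type*} [Field K] [Field F] [Algebra K F]

theorem essFiniteType_of_isCurveFunctionField [IsCurveFunctionField K F] :
    Algebra.EssFiniteType K F := by
  obtain ⟨x, -, hx⟩ := IsCurveFunctionField.exists_finite (K := K) (F := F)
  have : Algebra.EssFiniteType K K⟮x⟯ :=
    IntermediateField.essFiniteType_iff.2 ⟨{x}, by rw [Finset.coe_singleton]⟩
  exact Algebra.EssFiniteType.comp K K⟮x⟯ F

theorem nontrivial_kaehlerDifferential [IsCurveFunctionField K F] : Nontrivial Ω[F⁄K] := by
  by_contra h
  have := essFiniteType_of_isCurveFunctionField (K := K) (F := F)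
  have : Algebra.FormallyUnramified K F := ⟨not_nontrivial_iff_subsingleton.1 h⟩
  have := Algebra.FormallyUnramified.finite_of_free K F
  obtain ⟨x, hx, -⟩ := IsCurveFunctionField.exists_finite (K := K) (F := F)
  exact hx (Algebra.IsAlgebraic.isAlgebraic x)

theorem IsSeparating.finiteDimensional [IsCurveFunctionField K F] {x : F}
    (hx : IsSeparating K x) : FiniteDimensional K⟮x⟯ F := by
  have := essFiniteType_of_isCurveFunctionField (K := K) (F := F)
  have := hx.2
  have := Algebra.EssFiniteType.of_comp K K⟮x⟯ F
  have := Algebra.FormallyUnramified.of_isSeparable K⟮x⟯ F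
  exact Algebra.FormallyUnramified.finite_of_free K⟮x⟯ F

theorem isTranscendenceBasis_of_isAlgebraic_adjoin {x : F} (hx : Transcendental K x)
    [Algebra.IsAlgebraic K⟮x⟯ F] : IsTranscendenceBasis K fun _ : Unit => x := by
  have hindep : AlgebraicIndependent K fun _ : Unit => x :=
    (algebraicIndependent_unique_type_iff (ι := Unit)).2 hx
  rw [hindep.isTranscendenceBasis_iff_isAlgebraic, Set.range_const]
  exact IntermediateField.isAlgebraic_adjoin_iff_top.1 ‹_›

theorem exists_isSeparating [PerfectField K] [IsCurveFunctionField K F] :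
    ∃ x : F, IsSeparating K x := by
  have := essFiniteType_of_isCurveFunctionField (K := K) (F := F)
  obtain ⟨x, hx, hfin⟩ := IsCurveFunctionField.exists_finite (K := K) (F := F)
  obtain ⟨s, hs, hsep⟩ := exists_isTranscendenceBasis_and_isSeparable_of_perfectField K F
  have hcard : s.card = 1 := by
    simpa using hs.lift_cardinalMk_eq (isTranscendenceBasis_of_isAlgebraic_adjoin hx)
  obtain ⟨y, rfl⟩ := Finset.card_eq_one.1 hcard
  exact ⟨y, hs.1.transcendental ⟨y, Finset.mem_singleton_self y⟩,
    by rwa [Finset.coe_singleton] at hsep⟩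

end FunctionField

section PowersOfCharacteristic

theorem charP_of_charP_algebra (K : Type*) {F : Type*} [Field K] [Field F] [Algebra K F] (p : ℕ)
    [CharP F p] : CharP K p :=
  (RingHom.charP_iff (algebraMap K F) (algebraMap K F).injective p).2 inferInstance

variable {F : Type*} [Field F] {p : ℕ} [CharP F p]

theorem derivation_pow_char {K : Type*} [Field K] [Algebra K F] (f : F) :
    D K F (f ^ p) = 0 := by
  rw [Derivation.leibniz_pow, ← Nat.cast_smul_eq_nsmul F, CharP.cast_eq_zero, zero_smul]

variable [Fact p.Prime]

theorem exists_pow_char_eq {K : Type*} [Field K] [Algebra K F] [PerfectField K] (p : ℕ)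
    [Fact p.Prime] [CharP F p] (a : K) : ∃ b : K, b ^ p = a := by
  have := charP_of_charP_algebra K (F := F) p
  have : ExpChar K p := ExpChar.prime Fact.out
  exact surjective_frobenius K p a

theorem aeval_X_pow_sub_C_frobenius (y : F) :
    Polynomial.aeval y (Polynomial.X ^ p - Polynomial.C
      (⟨y ^ p, y, rfl⟩ : (frobenius F p).fieldRange)) = 0 := by
  rw [map_sub, map_pow, Polynomial.aeval_X, Polynomial.aeval_C]
  exact sub_self _

theorem isIntegral_frobenius_fieldRange (y : F) : IsIntegral (frobenius F p).fieldRange y :=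
  ⟨_, Polynomial.monic_X_pow_sub_C _ (Fact.out : p.Prime).ne_zero, aeval_X_pow_sub_C_frobenius y⟩

theorem natDegree_minpoly_frobenius_fieldRange {y : F} (hy : ∀ z : F, z ^ p ≠ y) :
    (minpoly (frobenius F p).fieldRange y).natDegree = p := by
  have hirr : Irreducible (Polynomial.X ^ p - Polynomial.C
      (⟨y ^ p, y, rfl⟩ : (frobenius F p).fieldRange)) := by
    refine X_pow_sub_C_irreducible_of_prime Fact.out ?_
    rintro ⟨_, w, rfl⟩ hw
    exact hy w ((frobenius F p).injective (congrArg Subtype.val hw))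
  rw [← minpoly.eq_of_irreducible_of_monic hirr (aeval_X_pow_sub_C_frobenius y)
    (Polynomial.monic_X_pow_sub_C _ (Fact.out : p.Prime).ne_zero), Polynomial.natDegree_X_pow_sub_C]

theorem linearIndependent_frobenius_fieldRange_pow {y : F} (hy : ∀ z : F, z ^ p ≠ y) :
    LinearIndependent (frobenius F p).fieldRange fun i : Fin p => y ^ (i : ℕ) := by
  have hindep := linearIndependent_pow (K := (frobenius F p).fieldRange) y
  rwa [natDegree_minpoly_frobenius_fieldRange hy] at hindep

variable {K : Type*} [Field K] [Algebra K F] [PerfectField K]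

/-- `F` is generated by its `p`-th powers over `K(x)`, because it is separable over it, and `K`
consists of `p`-th powers. -/
theorem IsSeparating.adjoin_frobenius_fieldRange_eq_top {x : F} (hx : IsSeparating K x) :
    IntermediateField.adjoin (frobenius F p).fieldRange {x} = ⊤ := by
  set M := IntermediateField.adjoin (frobenius F p).fieldRange {x}
  have pow_mem : ∀ f : F, f ^ p ∈ M := fun f => M.algebraMap_mem ⟨_, f, rfl⟩
  have algebraMap_mem : ∀ a : K, algebraMap K F a ∈ M.toSubfield := by
    intro a
    obtain ⟨b, rfl⟩ := exists_pow_char_eq (F := F) p a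
    rw [map_pow]
    exact pow_mem _
  have := hx.2
  have : CharP K⟮x⟯ p := charP_of_charP_algebra K⟮x⟯ (F := F) p
  have : ExpChar K⟮x⟯ p := ExpChar.prime Fact.out
  have hgen : IntermediateField.adjoin K ({x} ∪ (fun f : F => f ^ p) '' Set.univ) = ⊤ := by
    rw [← IntermediateField.adjoin_adjoin_left,
      ← IntermediateField.adjoin_eq_adjoin_pow_expChar_of_isSeparable',
      IntermediateField.adjoin_univ, IntermediateField.restrictScalars_top]
  have hle : IntermediateField.adjoin K ({x} ∪ (fun f : F => f ^ p) '' Set.univ) ≤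
      M.toSubfield.toIntermediateField algebraMap_mem := by
    rw [IntermediateField.adjoin_le_iff, Set.union_subset_iff, Set.singleton_subset_iff]
    refine ⟨IntermediateField.mem_adjoin_simple_self _ x, ?_⟩
    rintro _ ⟨f, -, rfl⟩
    exact pow_mem f
  rw [hgen] at hle
  exact eq_top_iff.2 fun f _ => hle (IntermediateField.mem_top (x := f))

variable [IsCurveFunctionField K F]

theorem exists_forall_pow_char_ne (K : Type*) [Field K] [Algebra K F] [IsCurveFunctionField K F]
    (p : ℕ) [CharP F p] : ∃ y : F, ∀ z : F, z ^ p ≠ y := by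
  by_contra! hpow
  have hD : ∀ y : F, D K F y = 0 := by
    intro y
    obtain ⟨z, rfl⟩ := hpow y
    exact derivation_pow_char z
  have := nontrivial_kaehlerDifferential (K := K) (F := F)
  refine bot_ne_top (α := Submodule F Ω[F⁄K]) ?_
  rw [← KaehlerDifferential.span_range_derivation, eq_comm, Submodule.span_eq_bot]
  rintro _ ⟨y, rfl⟩
  exact hD y

theorem IsSeparating.pow_char_ne {x : F} (hx : IsSeparating K x) (z : F) : z ^ p ≠ x := by
  intro hz
  obtain ⟨y, hy⟩ := exists_forall_pow_char_ne (F := F) K p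
  have hbot : IntermediateField.adjoin (frobenius F p).fieldRange {x} = ⊥ :=
    IntermediateField.adjoin_simple_eq_bot_iff.2
      (IntermediateField.algebraMap_mem ⊥ (⟨x, z, hz⟩ : (frobenius F p).fieldRange))
  have hy_mem : y ∈ IntermediateField.adjoin (frobenius F p).fieldRange {x} :=
    hx.adjoin_frobenius_fieldRange_eq_top ▸ IntermediateField.mem_top
  rw [hbot] at hy_mem
  obtain ⟨⟨_, w, rfl⟩, rfl⟩ := hy_mem
  exact hy w rfl

theorem finrank_frobenius_fieldRange (K : Type*) {F : Type*} [Field K] [Field F] [Algebra K F]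
    {p : ℕ} [Fact p.Prime] [CharP F p] [PerfectField K] [IsCurveFunctionField K F] :
    Module.finrank (frobenius F p).fieldRange F = p := by
  obtain ⟨x, hx⟩ := exists_isSeparating (K := K) (F := F)
  rw [← IntermediateField.finrank_top', ← hx.adjoin_frobenius_fieldRange_eq_top (p := p),
    IntermediateField.adjoin.finrank (isIntegral_frobenius_fieldRange x),
    natDegree_minpoly_frobenius_fieldRange hx.pow_char_ne]

end PowersOfCharacteristic

section FrobeniusBasis

variable {F : Type*} [Field F] {p : ℕ} [Fact p.Prime] [CharP F p]

/-- The basis `1, y, …, y ^ (p - 1)` of `F` over its subfield of `p`-th powers, for an element `y`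
which is not a `p`-th power, when that subfield has index `p`. -/
noncomputable def frobeniusBasis (hF : Module.finrank (frobenius F p).fieldRange F = p)
    {y : F} (hy : ∀ z : F, z ^ p ≠ y) : Module.Basis (Fin p) (frobenius F p).fieldRange F :=
  have : Nonempty (Fin p) := ⟨⟨0, (Fact.out : p.Prime).pos⟩⟩
  basisOfLinearIndependentOfCardEqFinrank (linearIndependent_frobenius_fieldRange_pow hy)
    (by rw [hF, Fintype.card_fin])

variable (hF : Module.finrank (frobenius F p).fieldRange F = p) {y : F} (hy : ∀ z : F, z ^ p ≠ y)

/-- The additive map `∑ i < p, a i ^ p * y ^ i ↦ a (p - 1)`. -/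
noncomputable def topCoeff : F →+ F :=
  (frobenius F p).rangeRestrictFieldEquiv.symm.toAddMonoidHom.comp
    ((frobeniusBasis hF hy).coord ⟨p - 1, Nat.pred_lt (Fact.out : p.Prime).ne_zero⟩).toAddMonoidHom

theorem topCoeff_apply (f : F) : topCoeff hF hy f =
    (frobenius F p).rangeRestrictFieldEquiv.symm ((frobeniusBasis hF hy).repr f
      ⟨p - 1, Nat.pred_lt (Fact.out : p.Prime).ne_zero⟩) := rfl

include hF hy in
theorem exists_eq_sum_pow_mul_pow (f : F) :
    ∃ a : ℕ → F, f = ∑ i ∈ Finset.range p, a i ^ p * y ^ i := by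
  choose w hw using fun i => ((frobeniusBasis hF hy).repr f i).2
  refine ⟨fun i => if h : i < p then w ⟨i, h⟩ else 0, ?_⟩
  rw [← Fin.sum_univ_eq_sum_range
    (fun i => (if h : i < p then w ⟨i, h⟩ else 0) ^ p * y ^ i) p]
  conv_lhs => rw [← (frobeniusBasis hF hy).sum_repr f]
  refine Finset.sum_congr rfl fun i _ => ?_
  rw [dif_pos i.2, Subfield.smul_def, smul_eq_mul, ← hw i, frobeniusBasis,
    coe_basisOfLinearIndependentOfCardEqFinrank]
  rfl

theorem topCoeff_pow_mul (g f : F) : topCoeff hF hy (g ^ p * f) = g * topCoeff hF hy f := by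
  have hsmul : g ^ p * f = (frobenius F p).rangeRestrictFieldEquiv g • f := rfl
  rw [topCoeff_apply, hsmul, map_smul, Finsupp.smul_apply, smul_eq_mul, map_mul,
    RingEquiv.symm_apply_apply, topCoeff_apply]

theorem topCoeff_pow {j : ℕ} (hj : j < p) :
    topCoeff hF hy (y ^ j) = if j = p - 1 then 1 else 0 := by
  have hbasis : y ^ j = frobeniusBasis hF hy ⟨j, hj⟩ := by
    rw [frobeniusBasis, coe_basisOfLinearIndependentOfCardEqFinrank]
  simp only [topCoeff_apply, hbasis, Module.Basis.repr_self, Finsupp.single_apply, Fin.mk.injEq]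
  split_ifs
  · exact map_one _
  · exact map_zero _

end FrobeniusBasis

section Cartier

variable {K F : Type*} [Field K] [PerfectField K] [Field F] [Algebra K F]
  [IsCurveFunctionField K F] {p : ℕ} [Fact p.Prime] [CharP F p]

theorem exists_smul_derivation_eq {y : F} (hy : ∀ z : F, z ^ p ≠ y) (ω : Ω[F⁄K]) :
    ∃ f : F, f • D K F y = ω := by
  rw [← Submodule.mem_span_singleton]
  have hspan : Submodule.span F (Set.range (D K F)) ≤ Submodule.span F {D K F y} := by
    rw [Submodule.span_le]
    rintro _ ⟨f, rfl⟩
    obtain ⟨a, rfl⟩ := exists_eq_sum_pow_mul_pow (finrank_frobenius_fieldRange K) hy f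
    rw [map_sum]
    refine Submodule.sum_mem _ fun i _ => ?_
    rw [Derivation.leibniz, Derivation.leibniz_pow, derivation_pow_char, smul_zero, add_zero]
    exact Submodule.smul_mem _ _ (Submodule.smul_of_tower_mem _ _ (Submodule.smul_mem _ _
      (Submodule.mem_span_singleton_self _)))
  exact hspan (KaehlerDifferential.span_range_derivation K F ▸ Submodule.mem_top)

theorem derivation_ne_zero {y : F} (hy : ∀ z : F, z ^ p ≠ y) : D K F y ≠ 0 := by
  intro hzero
  have := nontrivial_kaehlerDifferential (K := K) (F := F)
  obtain ⟨ω, hω⟩ := exists_ne (0 : Ω[F⁄K])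
  obtain ⟨f, rfl⟩ := exists_smul_derivation_eq hy ω
  exact hω (by rw [hzero, smul_zero])

variable (K) in
/-- The coordinate `f` of the differential `f dy`, for an element `y` which is not a `p`-th
power. -/
noncomputable def diffCoord {y : F} (hy : ∀ z : F, z ^ p ≠ y) : Ω[F⁄K] ≃ₗ[F] F :=
  (LinearEquiv.ofBijective (LinearMap.toSpanSingleton F Ω[F⁄K] (D K F y))
    ⟨smul_left_injective F (derivation_ne_zero hy), exists_smul_derivation_eq hy⟩).symm

@[simp]
theorem diffCoord_smul_derivation {y : F} (hy : ∀ z : F, z ^ p ≠ y) (f : F) :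
    diffCoord K hy (f • D K F y) = f :=
  (diffCoord K hy).apply_symm_apply f

@[simp]
theorem diffCoord_apply_smul_derivation {y : F} (hy : ∀ z : F, z ^ p ≠ y) (ω : Ω[F⁄K]) :
    diffCoord K hy ω • D K F y = ω :=
  (diffCoord K hy).symm_apply_apply ω

variable (K) in
/-- The Cartier operator computed with an element `y` which is not a `p`-th power; by
`cartierAt_sum_smul_derivation` it does not depend on `y`. -/
noncomputable def cartierAt {y : F} (hy : ∀ z : F, z ^ p ≠ y) : AddMonoid.End Ω[F⁄K] :=
  (diffCoord K hy).symm.toLinearMap.toAddMonoidHom.comp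
    ((topCoeff (finrank_frobenius_fieldRange K) hy).comp
      (diffCoord K hy).toLinearMap.toAddMonoidHom)

section CartierAt

variable {y : F} (hy : ∀ z : F, z ^ p ≠ y)

theorem cartierAt_apply (ω : Ω[F⁄K]) : cartierAt K hy ω =
    topCoeff (finrank_frobenius_fieldRange K) hy (diffCoord K hy ω) • D K F y := rfl

theorem cartierAt_pow_smul (g : F) (ω : Ω[F⁄K]) :
    cartierAt K hy (g ^ p • ω) = g • cartierAt K hy ω := by
  rw [cartierAt_apply, cartierAt_apply, map_smul, smul_eq_mul, topCoeff_pow_mul, mul_smul]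

theorem cartierAt_pow_smul_derivation_self {j : ℕ} (hj : j < p) :
    cartierAt K hy (y ^ j • D K F y) = if j = p - 1 then D K F y else 0 := by
  rw [cartierAt_apply, diffCoord_smul_derivation, topCoeff_pow _ hy hj, ite_smul, one_smul,
    zero_smul]

theorem cartierAt_derivation (f : F) : cartierAt K hy (D K F f) = 0 := by
  obtain ⟨a, rfl⟩ := exists_eq_sum_pow_mul_pow (finrank_frobenius_fieldRange K) hy f
  rw [map_sum, map_sum]
  refine Finset.sum_eq_zero fun i hi => ?_
  have hip : i - 1 < p := (Nat.sub_le i 1).trans_lt (Finset.mem_range.1 hi)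
  rw [Derivation.leibniz, derivation_pow_char (a i), smul_zero, add_zero, cartierAt_pow_smul,
    Derivation.leibniz_pow, map_nsmul, cartierAt_pow_smul_derivation_self hy hip]
  split_ifs with hpred
  · have hi0 : i = 0 := by have := Finset.mem_range.1 hi; omega
    rw [hi0, zero_smul, smul_zero]
  · rw [smul_zero, smul_zero]

theorem cartierAt_pow_smul_derivation (f : F) {j : ℕ} (hj : j + 1 < p) :
    cartierAt K hy (f ^ j • D K F f) = 0 := by
  have hexact := cartierAt_derivation (K := K) hy (f ^ (j + 1))
  rw [Derivation.leibniz_pow, Nat.add_sub_cancel, map_nsmul, ← Nat.cast_smul_eq_nsmul F] at hexact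
  refine (smul_eq_zero.1 hexact).resolve_left fun hcast => ?_
  exact Nat.not_dvd_of_pos_of_lt j.succ_pos hj ((CharP.cast_eq_zero_iff F p _).1 hcast)

/-- In logarithmic form, `𝒞(df / f) = df / f`: the set of all such `f` is a subfield. -/
theorem cartierAt_pow_pred_smul_derivation_mul {f g : F}
    (hf : cartierAt K hy (f ^ (p - 1) • D K F f) = D K F f)
    (hg : cartierAt K hy (g ^ (p - 1) • D K F g) = D K F g) :
    cartierAt K hy ((f * g) ^ (p - 1) • D K F (f * g)) = D K F (f * g) := by
  have hp : p - 1 + 1 = p := Nat.sub_add_cancel (Fact.out : p.Prime).one_le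
  have hsplit : (f * g) ^ (p - 1) • D K F (f * g) =
      f ^ p • (g ^ (p - 1) • D K F g) + g ^ p • (f ^ (p - 1) • D K F f) := by
    rw [Derivation.leibniz, smul_add, smul_smul, smul_smul, smul_smul, smul_smul, ← hp, pow_succ,
      pow_succ]
    congr 2 <;> (rw [Nat.add_sub_cancel]; ring)
  rw [hsplit, map_add, cartierAt_pow_smul, cartierAt_pow_smul, hf, hg, Derivation.leibniz]

theorem cartierAt_pow_pred_smul_derivation_pow {f : F}
    (hf : cartierAt K hy (f ^ (p - 1) • D K F f) = D K F f) (n : ℕ) :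
    cartierAt K hy ((f ^ n) ^ (p - 1) • D K F (f ^ n)) = D K F (f ^ n) := by
  induction n with
  | zero => rw [pow_zero, Derivation.map_one_eq_zero, smul_zero, map_zero]
  | succ n ih => rw [pow_succ]; exact cartierAt_pow_pred_smul_derivation_mul hy ih hf

theorem cartierAt_pow_pred_smul_derivation_add_one {f : F}
    (hf : cartierAt K hy (f ^ (p - 1) • D K F f) = D K F f) :
    cartierAt K hy ((f + 1) ^ (p - 1) • D K F (f + 1)) = D K F (f + 1) := by
  rw [map_add, Derivation.map_one_eq_zero, add_zero, add_pow, Finset.sum_smul,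
    Finset.sum_range_succ, map_add, map_sum, Finset.sum_eq_zero]
  · rw [one_pow, mul_one, Nat.choose_self, Nat.cast_one, mul_one, hf, zero_add]
  · intro j hj
    rw [one_pow, mul_one, mul_comm, mul_smul, Nat.cast_smul_eq_nsmul, map_nsmul,
      cartierAt_pow_smul_derivation hy f (Nat.add_lt_of_lt_sub (Finset.mem_range.1 hj)), smul_zero]

theorem cartierAt_pow_pred_smul_derivation_add {f g : F}
    (hf : cartierAt K hy (f ^ (p - 1) • D K F f) = D K F f)
    (hg : cartierAt K hy (g ^ (p - 1) • D K F g) = D K F g) :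
    cartierAt K hy ((f + g) ^ (p - 1) • D K F (f + g)) = D K F (f + g) := by
  rcases eq_or_ne g 0 with rfl | hg0
  · rwa [add_zero]
  have hp : p - 1 + 1 = p := Nat.sub_add_cancel (Fact.out : p.Prime).one_le
  have hquot : g⁻¹ ^ p * (f * g ^ (p - 1)) = f / g := by
    rw [← hp, pow_succ, hp, inv_pow]
    field_simp
  have hdiv : cartierAt K hy ((f / g) ^ (p - 1) • D K F (f / g)) = D K F (f / g) := by
    rw [← hquot]
    exact cartierAt_pow_pred_smul_derivation_mul hy
      (by rw [derivation_pow_char, smul_zero, map_zero])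
      (cartierAt_pow_pred_smul_derivation_mul hy hf
        (cartierAt_pow_pred_smul_derivation_pow hy hg _))
  have hfg : (f / g + 1) * g = f + g := by field_simp
  rw [← hfg]
  exact cartierAt_pow_pred_smul_derivation_mul hy
    (cartierAt_pow_pred_smul_derivation_add_one hy hdiv) hg

theorem cartierAt_pow_pred_smul_derivation (f : F) :
    cartierAt K hy (f ^ (p - 1) • D K F f) = D K F f := by
  have hp : p.Prime := Fact.out
  have hself : cartierAt K hy (y ^ (p - 1) • D K F y) = D K F y := by
    rw [cartierAt_pow_smul_derivation_self hy (Nat.sub_lt hp.pos Nat.one_pos), if_pos rfl]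
  obtain ⟨a, rfl⟩ := exists_eq_sum_pow_mul_pow (finrank_frobenius_fieldRange K) hy f
  refine Finset.sum_induction _
    (fun g => cartierAt K hy (g ^ (p - 1) • D K F g) = D K F g)
    (fun _ _ => cartierAt_pow_pred_smul_derivation_add hy) ?_ fun i _ => ?_
  · rw [zero_pow (Nat.sub_ne_zero_of_lt hp.one_lt), zero_smul, map_zero, map_zero]
  · exact cartierAt_pow_pred_smul_derivation_mul hy
      (by rw [derivation_pow_char, smul_zero, map_zero])
      (cartierAt_pow_pred_smul_derivation_pow hy hself i)

theorem cartierAt_sum_smul_derivation (a : ℕ → F) (x : F) :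
    cartierAt K hy ((∑ i ∈ Finset.range p, a i ^ p * x ^ i) • D K F x) =
      a (p - 1) • D K F x := by
  have hp : p - 1 + 1 = p := Nat.sub_add_cancel (Fact.out : p.Prime).one_le
  rw [Finset.sum_smul, map_sum, Finset.sum_eq_single (p - 1)]
  · rw [mul_smul, cartierAt_pow_smul, cartierAt_pow_pred_smul_derivation]
  · intro i hi hne
    rw [mul_smul, cartierAt_pow_smul, cartierAt_pow_smul_derivation hy x
      (by have := Finset.mem_range.1 hi; omega), smul_zero]
  · exact fun h => absurd (Finset.mem_range.2 (Nat.pred_lt (Fact.out : p.Prime).ne_zero)) h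

end CartierAt

variable (K F p) in
/-- The Cartier operator, as an endomorphism of the additive group of rational differentials; its
graph is `IsCartier`. -/
noncomputable def cartier : AddMonoid.End Ω[F⁄K] :=
  cartierAt K (exists_forall_pow_char_ne (F := F) K p).choose_spec

theorem cartier_pow_smul (g : F) (ω : Ω[F⁄K]) :
    cartier K F p (g ^ p • ω) = g • cartier K F p ω :=
  cartierAt_pow_smul _ g ω

theorem cartier_pow_pred_smul_derivation (f : F) :
    cartier K F p (f ^ (p - 1) • D K F f) = D K F f :=
  cartierAt_pow_pred_smul_derivation _ f

theorem cartier_sum_smul_derivation (a : ℕ → F) (x : F) :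
    cartier K F p ((∑ i ∈ Finset.range p, a i ^ p * x ^ i) • D K F x) = a (p - 1) • D K F x :=
  cartierAt_sum_smul_derivation _ a x

theorem isCartier_iff {ω η : Ω[F⁄K]} : IsCartier p ω η ↔ cartier K F p ω = η := by
  constructor
  · intro h
    obtain ⟨x, hx⟩ := exists_isSeparating (K := K) (F := F)
    obtain ⟨f, rfl, rfl⟩ := h x hx
    exact cartier_sum_smul_derivation f x
  · rintro rfl x hx
    obtain ⟨g, rfl⟩ := exists_smul_derivation_eq (hx.pow_char_ne (p := p)) ω
    obtain ⟨a, rfl⟩ := exists_eq_sum_pow_mul_pow (finrank_frobenius_fieldRange K) hx.pow_char_ne g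
    exact ⟨a, rfl, cartier_sum_smul_derivation a x⟩

theorem isCartierIter_iff {s : ℕ} {ω η : Ω[F⁄K]} :
    IsCartierIter p s ω η ↔ (cartier K F p ^ s) ω = η := by
  induction s generalizing ω with
  | zero => rfl
  | succ s ih =>
    rw [pow_succ]
    simp only [IsCartierIter, isCartier_iff, ih, exists_eq_left']
    rfl

theorem cartier_pow_apply_pow_smul (s : ℕ) (g : F) (ω : Ω[F⁄K]) :
    (cartier K F p ^ s) (g ^ p ^ s • ω) = g • (cartier K F p ^ s) ω := by
  induction s generalizing ω with
  | zero => simp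
  | succ s ih =>
    rw [pow_succ, pow_succ, pow_mul]
    exact (congrArg _ (cartier_pow_smul _ ω)).trans (ih _)

end Cartier

theorem valuation_le_valuation_sum {R Γ₀ ι : Type*} [Ring R] [LinearOrderedCommGroupWithZero Γ₀]
    (v : Valuation R Γ₀) {s : Finset ι} {f : ι → R}
    (hf : ∀ i ∈ s, ∀ j ∈ s, i ≠ j → v (f i) ≠ 0 → v (f i) ≠ v (f j)) {i : ι} (hi : i ∈ s) :
    v (f i) ≤ v (∑ j ∈ s, f j) := by
  classical
  obtain ⟨j, hj, hmax⟩ := s.exists_max_image (fun i => v (f i)) ⟨i, hi⟩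
  rcases eq_or_ne (v (f j)) 0 with hzero | hzero
  · exact ((hmax i hi).trans_eq hzero).trans zero_le
  rw [v.map_sum_eq_of_lt hj]
  · exact hmax i hi
  · intro l hl
    rw [Finset.mem_sdiff, Finset.mem_singleton] at hl
    exact lt_of_le_of_ne (hmax l hl.1) (hf j hj l hl.1 (Ne.symm hl.2) hzero).symm

namespace Place

variable {K F : Type*} [Field K] [Field F] [Algebra K F] {P : Place K F}

theorem mem_localRing_iff {f : F} : f ∈ P.localRing ↔ P.valuation f ≤ 1 := by
  constructor
  · exact fun hf =>
      (IsDiscreteValuationRing.maximalIdeal P.localRing).valuation_le_one ⟨f, hf⟩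
  · intro hf
    obtain ⟨g, rfl⟩ := IsDiscreteValuationRing.exists_lift_of_le_one hf
    exact g.2

theorem ordGE_zero_iff {f : F} : P.OrdGE 0 f ↔ f ∈ P.localRing := by
  rw [mem_localRing_iff, OrdGE, neg_zero, WithZero.exp_zero]

theorem ordGE_zero (P : Place K F) (m : ℤ) : P.OrdGE m 0 := by
  rw [OrdGE, map_zero]
  exact zero_le

theorem OrdGE.mono {m n : ℤ} {f : F} (h : P.OrdGE n f) (hmn : m ≤ n) : P.OrdGE m f :=
  h.trans (WithZero.exp_le_exp.2 (neg_le_neg hmn))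

theorem OrdGE.mul {m n : ℤ} {f g : F} (hf : P.OrdGE m f) (hg : P.OrdGE n g) :
    P.OrdGE (m + n) (f * g) := by
  rw [OrdGE, map_mul, neg_add, WithZero.exp_add]
  exact mul_le_mul' hf hg

theorem OrdGE.sub {m : ℤ} {f g : F} (hf : P.OrdGE m f) (hg : P.OrdGE m g) :
    P.OrdGE m (f - g) :=
  (P.valuation.map_sub f g).trans (max_le hf hg)

theorem valuation_algebraMap (P : Place K F) {a : K} (ha : a ≠ 0) :
    P.valuation (algebraMap K F a) = 1 := by
  refine le_antisymm (mem_localRing_iff.1 (P.algebraMap_mem a)) ?_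
  have hinv := mem_localRing_iff.1 (P.algebraMap_mem a⁻¹)
  rwa [map_inv₀, map_inv₀, inv_le_one₀] at hinv
  exact zero_lt_iff.2 ((Valuation.ne_zero_iff _).2 ((map_ne_zero _).2 ha))

theorem exists_isUniformizer (P : Place K F) : ∃ t, P.IsUniformizer t :=
  (IsDiscreteValuationRing.maximalIdeal P.localRing).valuation_exists_uniformizer F

namespace IsUniformizer

variable {t : F}

theorem ne_zero (ht : P.IsUniformizer t) : t ≠ 0 := by
  rintro rfl
  rw [IsUniformizer, map_zero] at ht
  exact WithZero.exp_ne_zero ht.symm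

theorem ordGE_one (ht : P.IsUniformizer t) : P.OrdGE 1 t := ht.le

theorem mem_localRing (ht : P.IsUniformizer t) : t ∈ P.localRing :=
  ordGE_zero_iff.1 (ht.ordGE_one.mono zero_le_one)

theorem valuation_zpow (ht : P.IsUniformizer t) (n : ℤ) :
    P.valuation (t ^ n) = WithZero.exp (-n) := by
  rw [map_zpow₀, ht, ← WithZero.exp_zsmul, smul_neg, smul_eq_mul, mul_one]

theorem ordGE_zpow (ht : P.IsUniformizer t) (n : ℤ) : P.OrdGE n (t ^ n) :=
  (ht.valuation_zpow n).le

theorem log_valuation_pow_mul_pow (ht : P.IsUniformizer t) {f : F} (hf : f ≠ 0)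
    (p i : ℕ) :
    WithZero.log (P.valuation (f ^ p * t ^ i)) = p * WithZero.log (P.valuation f) - i := by
  have hv : ∀ {g : F} (n : ℕ), g ≠ 0 → P.valuation g ^ n ≠ 0 := fun n hg =>
    pow_ne_zero n ((Valuation.ne_zero_iff _).2 hg)
  rw [map_mul, map_pow, map_pow, WithZero.log_mul (hv _ hf) (hv _ ht.ne_zero), WithZero.log_pow,
    WithZero.log_pow, ht, WithZero.log_exp, nsmul_eq_mul, nsmul_eq_mul]
  ring

variable {p : ℕ} [Fact p.Prime]

theorem pow_char_ne (ht : P.IsUniformizer t) (z : F) : z ^ p ≠ t := by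
  rintro rfl
  have hlog := congrArg WithZero.log ht
  rw [map_pow, WithZero.log_pow, WithZero.log_exp, nsmul_eq_mul, eq_neg_iff_add_eq_zero] at hlog
  have hdvd : (p : ℤ) ∣ 1 := ⟨-WithZero.log (P.valuation z), by linarith⟩
  exact (Fact.out : p.Prime).not_dvd_one (by exact_mod_cast hdvd)

theorem mem_localRing_of_sum_mem (ht : P.IsUniformizer t) {a : ℕ → F}
    (h : ∑ i ∈ Finset.range p, a i ^ p * t ^ i ∈ P.localRing) {i : ℕ} (hi : i < p) :
    a i ∈ P.localRing := by
  have hp : p ≠ 0 := (Fact.out : p.Prime).ne_zero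
  have hv : ∀ j, P.valuation (a j ^ p * t ^ j) ≠ 0 ↔ a j ≠ 0 := fun j => by
    rw [Valuation.ne_zero_iff, mul_ne_zero_iff, pow_ne_zero_iff hp,
      and_iff_left (pow_ne_zero j ht.ne_zero)]
  have hterm : P.valuation (a i ^ p * t ^ i) ≤ 1 := by
    refine (valuation_le_valuation_sum P.valuation (fun j hj l hl hjl hj0 heq => ?_)
      (Finset.mem_range.2 hi)).trans (mem_localRing_iff.1 h)
    have hl0 := (hv l).1 (heq ▸ hj0)
    have hlog := congrArg WithZero.log heq
    rw [ht.log_valuation_pow_mul_pow ((hv j).1 hj0), ht.log_valuation_pow_mul_pow hl0] at hlog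
    have hdvd : (p : ℤ) ∣ (j : ℤ) - l :=
      ⟨WithZero.log (P.valuation (a j)) - WithZero.log (P.valuation (a l)), by linarith⟩
    have hj := Finset.mem_range.1 hj
    have hl := Finset.mem_range.1 hl
    have := Int.eq_zero_of_abs_lt_dvd hdvd (by rw [abs_lt]; constructor <;> omega)
    exact hjl (by omega)
  rcases eq_or_ne (a i) 0 with hai | hai
  · rw [hai]
    exact zero_mem _
  rw [mem_localRing_iff, ← WithZero.exp_zero, ← WithZero.log_le_iff_le_exp
    ((Valuation.ne_zero_iff _).2 hai)]
  rw [← WithZero.exp_zero, ← WithZero.log_le_iff_le_exp ((hv i).2 hai),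
    ht.log_valuation_pow_mul_pow hai] at hterm
  by_contra! hlog
  have hp_le : (p : ℤ) * 1 ≤ p * WithZero.log (P.valuation (a i)) :=
    mul_le_mul_of_nonneg_left hlog (Int.natCast_nonneg p)
  omega

variable [CharP F p] [PerfectField K] [IsCurveFunctionField K F]

theorem exists_derivation_eq (p : ℕ) [Fact p.Prime] [CharP F p] (ht : P.IsUniformizer t) {f : F}
    (hf : f ∈ P.localRing) : ∃ u ∈ P.localRing, D K F f = u • D K F t := by
  obtain ⟨a, rfl⟩ :=
    exists_eq_sum_pow_mul_pow (finrank_frobenius_fieldRange K) (ht.pow_char_ne (p := p)) f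
  refine ⟨∑ i ∈ Finset.range p, a i ^ p * (i * t ^ (i - 1)), sum_mem fun i hi => ?_, ?_⟩
  · have ha := ht.mem_localRing_of_sum_mem hf (Finset.mem_range.1 hi)
    exact mul_mem (pow_mem ha p) (mul_mem (natCast_mem _ i) (pow_mem ht.mem_localRing _))
  · rw [map_sum, Finset.sum_smul]
    refine Finset.sum_congr rfl fun i _ => ?_
    rw [Derivation.leibniz, derivation_pow_char (p := p) (a i), smul_zero, add_zero,
      Derivation.leibniz_pow, ← Nat.cast_smul_eq_nsmul F, smul_smul, smul_smul, mul_assoc]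

theorem diffOrdGE_smul_derivation_iff (p : ℕ) [Fact p.Prime] [CharP F p] (ht : P.IsUniformizer t)
    {f : F} {m : ℤ} : P.DiffOrdGE m (f • D K F t) ↔ P.OrdGE m f := by
  constructor
  · intro h
    obtain ⟨g, hg, hfg⟩ := h t ht
    rwa [smul_left_injective F (derivation_ne_zero (p := p) ht.pow_char_ne) hfg]
  · intro hf t' ht'
    obtain ⟨u, hu, hdt⟩ := ht'.exists_derivation_eq p ht.mem_localRing
    have hfu := hf.mul (ordGE_zero_iff.2 hu)
    rw [add_zero] at hfu
    exact ⟨f * u, hfu, by rw [hdt, smul_smul]⟩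

end IsUniformizer

section Differentials

variable {ω η : Ω[F⁄K]}

theorem DiffOrdGE.mono {m n : ℤ} (h : P.DiffOrdGE n ω) (hmn : m ≤ n) : P.DiffOrdGE m ω := by
  intro t ht
  obtain ⟨f, hf, rfl⟩ := h t ht
  exact ⟨f, hf.mono hmn, rfl⟩

theorem DiffOrdGE.sub {m : ℤ} (hω : P.DiffOrdGE m ω) (hη : P.DiffOrdGE m η) :
    P.DiffOrdGE m (ω - η) := by
  intro t ht
  obtain ⟨f, hf, rfl⟩ := hω t ht
  obtain ⟨g, hg, rfl⟩ := hη t ht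
  exact ⟨f - g, hf.sub hg, (sub_smul f g _).symm⟩

variable {p : ℕ} [Fact p.Prime] [CharP F p] [PerfectField K] [IsCurveFunctionField K F]

theorem DiffOrdGE.zpow_smul (p : ℕ) [Fact p.Prime] [CharP F p] {m : ℤ} {t : F}
    (ht : P.IsUniformizer t) (hω : P.DiffOrdGE m ω) (n : ℤ) : P.DiffOrdGE (n + m) (t ^ n • ω) := by
  obtain ⟨f, hf, rfl⟩ := hω t ht
  rw [smul_smul]
  exact (ht.diffOrdGE_smul_derivation_iff p).2 ((ht.ordGE_zpow n).mul hf)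

theorem DiffOrdGE.cartier_zero (hω : P.DiffOrdGE 0 ω) : P.DiffOrdGE 0 (cartier K F p ω) := by
  obtain ⟨t, ht⟩ := P.exists_isUniformizer
  obtain ⟨f, hf, rfl⟩ := hω t ht
  obtain ⟨a, rfl⟩ :=
    exists_eq_sum_pow_mul_pow (finrank_frobenius_fieldRange K) (ht.pow_char_ne (p := p)) f
  rw [cartier_sum_smul_derivation, ht.diffOrdGE_smul_derivation_iff p, ordGE_zero_iff]
  exact ht.mem_localRing_of_sum_mem (ordGE_zero_iff.1 hf)
    (Nat.sub_lt (Fact.out : p.Prime).pos one_pos)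

/-- Multiplication by `t ^ (-p * n)` reduces the statement to regular differentials. -/
theorem DiffOrdGE.cartier {n : ℤ} (hω : P.DiffOrdGE (p * n) ω) :
    P.DiffOrdGE n (cartier K F p ω) := by
  obtain ⟨t, ht⟩ := P.exists_isUniformizer
  have hregular := hω.zpow_smul p ht (-n * p)
  rw [show -n * p + p * n = 0 by ring, zpow_mul, zpow_natCast] at hregular
  have hC := hregular.cartier_zero (p := p)
  rw [cartier_pow_smul] at hC
  have hscaled := hC.zpow_smul p ht n
  rwa [add_zero, smul_smul, ← zpow_add₀ ht.ne_zero, add_neg_cancel, zpow_zero, one_smul]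
    at hscaled

theorem DiffOrdGE.cartier_pow {s : ℕ} {n : ℤ} (hω : P.DiffOrdGE (p ^ s * n) ω) :
    P.DiffOrdGE n ((AGCode.cartier K F p ^ s) ω) := by
  induction s generalizing ω with
  | zero => rwa [pow_zero, one_mul] at hω
  | succ s ih =>
    rw [pow_succ'] at hω
    rw [pow_succ, AddMonoid.End.coe_mul, Function.comp_apply]
    exact ih (DiffOrdGE.cartier (by rwa [← mul_assoc]))

end Differentials

end Place

section LogarithmicDifferentials

variable {K F : Type*} [Field K] [PerfectField K] [Field F] [Algebra K F]
  [IsCurveFunctionField K F] {p : ℕ} [Fact p.Prime] [CharP F p]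

theorem cartier_inv_smul_derivation (f : F) :
    cartier K F p (f⁻¹ • D K F f) = f⁻¹ • D K F f := by
  rcases eq_or_ne f 0 with rfl | hf
  · rw [inv_zero, zero_smul, map_zero]
  have hp : p - 1 + 1 = p := Nat.sub_add_cancel (Fact.out : p.Prime).one_le
  have hinv : f⁻¹ = f⁻¹ ^ p * f ^ (p - 1) := by
    rw [← hp, pow_succ', hp, mul_assoc, ← mul_pow, inv_mul_cancel₀ hf, one_pow, mul_one]
  conv_lhs => rw [hinv, mul_smul, cartier_pow_smul, cartier_pow_pred_smul_derivation]

theorem cartier_pow_apply_mul_inv_smul_derivation (s : ℕ) (g f : F) :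
    (cartier K F p ^ s) ((g ^ p ^ s * f⁻¹) • D K F f) = (g * f⁻¹) • D K F f := by
  have hfixed : (cartier K F p ^ s) (f⁻¹ • D K F f) = f⁻¹ • D K F f := by
    induction s with
    | zero => rfl
    | succ s ih =>
      rw [pow_succ, AddMonoid.End.coe_mul, Function.comp_apply, cartier_inv_smul_derivation, ih]
  rw [mul_smul, cartier_pow_apply_pow_smul, hfixed, mul_smul]

end LogarithmicDifferentials

namespace Place

variable {K F : Type*} [Field K] [Field F] [Algebra K F] {P : Place K F}

theorem sum_range_mul_inv_pow_eq {t : F} (ht : P.IsUniformizer t) (c : ℕ → K) {N : ℕ}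
    (h : P.OrdGE (-1) (∑ i ∈ Finset.range (N + 1), algebraMap K F (c i) * (t ^ (i + 1))⁻¹)) :
    ∑ i ∈ Finset.range (N + 1), algebraMap K F (c i) * (t ^ (i + 1))⁻¹ =
      algebraMap K F (c 0) * t⁻¹ := by
  have hv : ∀ i, c i ≠ 0 →
      P.valuation (algebraMap K F (c i) * (t ^ (i + 1))⁻¹) = WithZero.exp (i + 1 : ℤ) := by
    intro i hi
    rw [map_mul, P.valuation_algebraMap hi, one_mul, ← zpow_natCast, ← zpow_neg,
      ht.valuation_zpow, neg_neg, Nat.cast_succ]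
  have hc : ∀ i ∈ Finset.range (N + 1), i ≠ 0 → c i = 0 := by
    intro i hi hi0
    by_contra hci
    have hle := (valuation_le_valuation_sum P.valuation (fun j _ l _ hjl hj0 heq => ?_) hi).trans h
    · rw [hv i hci, WithZero.exp_le_exp] at hle
      omega
    · have hcj : c j ≠ 0 := fun hcj => hj0 (by rw [hcj, map_zero, zero_mul, map_zero])
      have hcl : c l ≠ 0 := fun hcl => hj0 (by rw [heq, hcl, map_zero, zero_mul, map_zero])
      rw [hv j hcj, hv l hcl, WithZero.exp_inj] at heq
      exact hjl (by omega)
  rw [Finset.sum_eq_single 0, zero_add, pow_one]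
  · intro i hi hi0
    rw [hc i hi hi0, map_zero, zero_mul]
  · exact fun h0 => absurd (Finset.mem_range.2 N.succ_pos) h0

theorem ordGE_const_mul_inv_iff {t : F} (ht : P.IsUniformizer t) {a : K} :
    P.OrdGE 0 (algebraMap K F a * t⁻¹) ↔ a = 0 := by
  constructor
  · intro h
    by_contra ha
    rw [OrdGE, map_mul, P.valuation_algebraMap ha, one_mul, ← zpow_neg_one, ht.valuation_zpow,
      WithZero.exp_le_exp] at h
    omega
  · rintro rfl
    rw [map_zero, zero_mul]
    exact ordGE_zero P 0

variable {p : ℕ} [Fact p.Prime] [CharP F p] [PerfectField K] [IsCurveFunctionField K F]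
  {ω : Ω[F⁄K]} {s : ℕ}

theorem HasResidue.diffOrdGE_sub (p : ℕ) [Fact p.Prime] [CharP F p] {a : K}
    (ha : P.HasResidue ω a) (hω : P.DiffOrdGE (-1) ω) {t : F} (ht : P.IsUniformizer t) :
    P.DiffOrdGE 0 (ω - (algebraMap K F a * t⁻¹) • D K F t) := by
  obtain ⟨N, c, r, hr, rfl, rfl⟩ := ha t ht
  rw [ht.diffOrdGE_smul_derivation_iff p] at hω
  have hr0 : P.OrdGE 0 r := ordGE_zero_iff.2 hr
  have hprincipal := hω.sub (hr0.mono (by norm_num))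
  rw [add_sub_cancel_right] at hprincipal
  rw [sum_range_mul_inv_pow_eq ht c hprincipal, ← sub_smul, add_sub_cancel_left]
  exact (ht.diffOrdGE_smul_derivation_iff p).2 hr0

theorem HasResidue.diffOrdGE_cartier_pow_sub {b : K} (hb : P.HasResidue ω (b ^ p ^ s))
    (hω : P.DiffOrdGE (-1) ω) {t : F} (ht : P.IsUniformizer t) :
    P.DiffOrdGE 0 ((cartier K F p ^ s) ω - (algebraMap K F b * t⁻¹) • D K F t) := by
  have hregular := hb.diffOrdGE_sub p hω ht
  rw [← mul_zero ((p : ℤ) ^ s)] at hregular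
  have hC := hregular.cartier_pow
  rwa [map_sub, map_pow, cartier_pow_apply_mul_inv_smul_derivation] at hC

theorem HasResidue.diffOrdGE_cartier_pow_sub_self {a : K} (ha : P.HasResidue ω a)
    (hω : P.DiffOrdGE (-1) ω) (hpow : a ^ p ^ s = a) :
    P.DiffOrdGE 0 ((cartier K F p ^ s) ω - ω) := by
  obtain ⟨t, ht⟩ := P.exists_isUniformizer
  have hC := HasResidue.diffOrdGE_cartier_pow_sub (hpow.symm ▸ ha) hω ht
  simpa only [sub_sub_sub_cancel_right] using hC.sub (ha.diffOrdGE_sub p hω ht)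

theorem HasResidue.pow_eq_self_of_cartier_pow_eq {a : K} (ha : P.HasResidue ω a)
    (hω : P.DiffOrdGE (-1) ω) (hC : (cartier K F p ^ s) ω = ω) : a ^ p ^ s = a := by
  have := charP_of_charP_algebra K (F := F) p
  have : ExpChar K p := ExpChar.prime Fact.out
  obtain ⟨b, rfl⟩ : ∃ b : K, b ^ p ^ s = a := (bijective_iterateFrobenius K p s).2 a
  obtain ⟨t, ht⟩ := P.exists_isUniformizer
  have hdiff := (ha.diffOrdGE_cartier_pow_sub hω ht).sub (ha.diffOrdGE_sub p hω ht)
  rw [hC, sub_sub_sub_cancel_left, ← sub_smul, ← sub_mul, ← map_sub,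
    ht.diffOrdGE_smul_derivation_iff p, ordGE_const_mul_inv_iff ht, sub_eq_zero] at hdiff
  rw [hdiff, hdiff]

end Place

section DedekindModel

open IsDedekindDomain

variable {B F : Type*} [CommRing B] [Field F] [Algebra B F] {V : ValuationSubring F}

theorem inv_mem_of_notMem_comap_maximalIdeal (hV : ∀ b : B, algebraMap B F b ∈ V) {b : B}
    (hb : b ∉ (IsLocalRing.maximalIdeal V).comap ((algebraMap B F).codRestrict V hV)) :
    (algebraMap B F b)⁻¹ ∈ V := by
  rw [Ideal.mem_comap, ValuationSubring.valuation_lt_one_iff, not_lt] at hb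
  rw [← ValuationSubring.valuation_le_one_iff, map_inv₀]
  exact inv_le_one_of_one_le₀ hb

variable [IsDedekindDomain B] [IsFractionRing B F]

theorem isDiscreteValuationRing_valuationSubring (v : HeightOneSpectrum B) :
    IsDiscreteValuationRing (v.valuation F).valuationSubring := by
  rw [← v.valuationSubringAtPrime_eq_valuationSubring]
  exact IsLocalization.AtPrime.isDiscreteValuationRing_of_dedekind_domain B v.ne_bot _

theorem exists_valuationSubring_eq (hV : ∀ b : B, algebraMap B F b ∈ V) (hne : V ≠ ⊤) :
    ∃ v : HeightOneSpectrum B, (v.valuation F).valuationSubring = V := by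
  set center := (IsLocalRing.maximalIdeal V).comap ((algebraMap B F).codRestrict V hV)
  have center_ne_bot : center ≠ ⊥ := by
    intro hbot
    refine hne (eq_top_iff.2 fun f _ => ?_)
    obtain ⟨b, s, hs, rfl⟩ := IsFractionRing.div_surjective B f
    have hs_center : s ∉ center := by
      rw [hbot, Ideal.mem_bot]
      exact nonZeroDivisors.ne_zero hs
    rw [div_eq_mul_inv]
    exact mul_mem (hV b) (inv_mem_of_notMem_comap_maximalIdeal hV hs_center)
  let v : HeightOneSpectrum B := ⟨center, Ideal.IsPrime.comap _, center_ne_bot⟩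
  refine ⟨v, ?_⟩
  rw [← v.valuationSubringAtPrime_eq_valuationSubring]
  refine ValuationSubring.eq_of_le_of_ne_top _ ?_ hne
  rintro _ ⟨b, s, hs, rfl⟩
  exact mul_mem (hV b) (inv_mem_of_notMem_comap_maximalIdeal hV hs)

theorem derivation_mem_valuationSubring {R : Type*} [CommRing R] [Algebra R F]
    (d : Derivation R F F) (v : HeightOneSpectrum B)
    (hd : ∀ b : B, d (algebraMap B F b) ∈ (v.valuation F).valuationSubring) {f : F}
    (hf : f ∈ (v.valuation F).valuationSubring) : d f ∈ (v.valuation F).valuationSubring := by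
  obtain ⟨b, s, hfs⟩ := v.exists_primeCompl_mul_eq_of_integer f hf
  have hs : v.valuation F (algebraMap B F s) = 1 := by
    rw [v.valuation_of_algebraMap, v.intValuation_eq_one_iff_mem_primeCompl]
    exact s.2
  have hs_inv : (algebraMap B F s)⁻¹ ∈ (v.valuation F).valuationSubring := by
    rw [Valuation.mem_valuationSubring_iff, map_inv₀, hs, inv_one]
  have hs_ne : algebraMap B F s ≠ 0 := by
    rw [← Valuation.ne_zero_iff (v.valuation F), hs]
    exact one_ne_zero
  have hleibniz := congrArg d hfs
  rw [d.leibniz, smul_eq_mul, smul_eq_mul] at hleibniz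
  have hdf : d f = (algebraMap B F s)⁻¹ * (d (algebraMap B F b) - f * d (algebraMap B F s)) := by
    rw [← hleibniz, add_sub_cancel_left, inv_mul_cancel_left₀ hs_ne]
  rw [hdf]
  exact mul_mem hs_inv (sub_mem (hd b) (mul_mem hf (hd s)))

theorem exists_valuation_sub_algebraMap_lt_one (v : HeightOneSpectrum B) {f : F}
    (hf : v.valuation F f ≤ 1) : ∃ b : B, v.valuation F (f - algebraMap B F b) < 1 := by
  obtain ⟨b, s, hfs⟩ := v.exists_primeCompl_mul_eq_of_integer f hf
  obtain ⟨r, a, ha, hsum⟩ := v.isMaximal.exists_inv s.2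
  refine ⟨r * b, ?_⟩
  have hsub : f - algebraMap B F (r * b) = f * algebraMap B F a := by
    rw [map_mul, ← hfs, mul_left_comm, ← map_mul, ← mul_one_sub, ← map_one (algebraMap B F),
      ← map_sub, ← hsum, add_sub_cancel_left]
  rw [hsub, map_mul]
  exact mul_lt_one_of_nonneg_of_lt_one_right hf zero_le ((v.valuation_lt_one_iff_mem a).2 ha)

end DedekindModel

section AffineModel

variable {K F : Type*} [Field K] [Field F] [Algebra K F]

/-- `B` is the coordinate ring of a nonsingular affine model of the curve with function
field `F`. -/
structure IsAffineModel (B : Subalgebra K F) : Prop where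
  isDedekindDomain : IsDedekindDomain B
  isFractionRing : IsFractionRing B F
  finiteType : Algebra.FiniteType K B

theorem isPrincipalIdealRing_adjoin_singleton (x : F) :
    IsPrincipalIdealRing (Algebra.adjoin K {x}) := by
  refine IsPrincipalIdealRing.of_surjective
    (Polynomial.aeval (R := K)
      (⟨x, Algebra.self_mem_adjoin_singleton K x⟩ : Algebra.adjoin K {x})) ?_
  rintro ⟨z, hz⟩
  obtain ⟨q, rfl⟩ := (Algebra.adjoin_singleton_eq_range_aeval K x).le hz
  exact ⟨q, Subtype.ext (Polynomial.aeval_algHom_apply (Algebra.adjoin K {x}).val _ q).symm⟩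

open IntermediateField.algebraAdjoinAdjoin in
theorem IsSeparating.isAffineModel_integralClosure [IsCurveFunctionField K F] {x : F}
    (hx : IsSeparating K x) :
    IsAffineModel ((integralClosure (Algebra.adjoin K {x}) F).restrictScalars K) := by
  have := hx.2
  have := hx.finiteDimensional
  have := isPrincipalIdealRing_adjoin_singleton (K := K) x
  have hfinite : Module.Finite (Algebra.adjoin K {x}) (integralClosure (Algebra.adjoin K {x}) F) :=
    IsIntegralClosure.finite _ K⟮x⟯ F _
  have hfiniteType : Algebra.FiniteType K (Algebra.adjoin K {x}) :=
    (Subalgebra.fg_iff_finiteType _).1 ⟨{x}, by rw [Finset.coe_singleton]⟩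
  have hfiniteType_closure : Algebra.FiniteType K (integralClosure (Algebra.adjoin K {x}) F) :=
    hfiniteType.trans inferInstance
  exact ⟨integralClosure.isDedekindDomain _ K⟮x⟯ F,
    integralClosure.isFractionRing_of_finite_extension K⟮x⟯ F, hfiniteType_closure⟩

theorem integralClosure_adjoin_le_valuationSubring {V : ValuationSubring F}
    (hK : ∀ a : K, algebraMap K F a ∈ V) {x : F} (hx : x ∈ V) :
    (integralClosure (Algebra.adjoin K {x}) F).toSubring ≤ V.toSubring := by
  have : IsIntegrallyClosedIn V.toSubring F := inferInstanceAs (IsIntegrallyClosedIn V F)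
  have hadjoin : Algebra.adjoin K {x} ≤ { V.toSubring with algebraMap_mem' := hK } :=
    Algebra.adjoin_le (Set.singleton_subset_iff.2 hx)
  exact Subring.integralClosure_le_iff.2 fun a => hadjoin a.2

theorem IsSeparating.inv {x : F} (hx : IsSeparating K x) : IsSeparating K x⁻¹ := by
  have hadjoin : K⟮x⁻¹⟯ = K⟮x⟯ := by
    refine le_antisymm ?_ ?_ <;> rw [IntermediateField.adjoin_simple_le_iff]
    · exact inv_mem (IntermediateField.mem_adjoin_simple_self K x)
    · exact inv_mem_iff.1 (IntermediateField.mem_adjoin_simple_self K x⁻¹)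
  exact ⟨fun halg => hx.1 (inv_inv x ▸ halg.inv), hadjoin ▸ hx.2⟩

variable [PerfectField K] [IsCurveFunctionField K F]

variable (K F) in
theorem exists_isAffineModel_cover :
    ∃ B B' : Subalgebra K F, IsAffineModel B ∧ IsAffineModel B' ∧
      ∀ V : ValuationSubring F, (∀ a : K, algebraMap K F a ∈ V) →
        (∀ b : B, algebraMap B F b ∈ V) ∨ (∀ b : B', algebraMap B' F b ∈ V) := by
  obtain ⟨x, hx⟩ := exists_isSeparating (K := K) (F := F)
  refine ⟨_, _, hx.isAffineModel_integralClosure, hx.inv.isAffineModel_integralClosure,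
    fun V hV => (V.mem_or_inv_mem x).imp (fun h b => ?_) (fun h b => ?_)⟩ <;>
  exact integralClosure_adjoin_le_valuationSubring hV h b.2

end AffineModel

namespace Place

open IsDedekindDomain

variable {K F : Type*} [Field K] [Field F] [Algebra K F] {P : Place K F}

theorem localRing_injective :
    Function.Injective (localRing : Place K F → ValuationSubring F) := by
  rintro ⟨V, hV, hV'⟩ ⟨W, hW, hW'⟩ rfl
  rfl

theorem localRing_ne_top (P : Place K F) : P.localRing ≠ ⊤ := by
  intro htop
  obtain ⟨t, ht⟩ := P.exists_isUniformizer
  have hinv : t⁻¹ ∈ P.localRing := htop ▸ ValuationSubring.mem_top _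
  rw [mem_localRing_iff, ← zpow_neg_one, ht.valuation_zpow, ← WithZero.exp_zero,
    WithZero.exp_le_exp] at hinv
  omega

theorem exists_ordGE (P : Place K F) (f : F) : ∃ n : ℤ, P.OrdGE n f :=
  ⟨-WithZero.log (P.valuation f), by rw [OrdGE, neg_neg]; exact WithZero.le_exp_log⟩

theorem ordGE_one_iff {f : F} : P.OrdGE 1 f ↔ P.valuation f < 1 := by
  rw [OrdGE, ← WithZero.lt_mul_exp_iff_le WithZero.exp_ne_zero, ← WithZero.exp_add,
    neg_add_cancel, WithZero.exp_zero]

theorem ordGE_one_iff_valuation_lt_one {Γ₀ : Type*} [LinearOrderedCommGroupWithZero Γ₀]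
    {v : Valuation F Γ₀} (hv : v.valuationSubring = P.localRing) {f : F} :
    P.OrdGE 1 f ↔ v f < 1 := by
  have hequiv : P.valuation.IsEquiv v := by
    rw [Valuation.isEquiv_iff_valuationSubring, hv]
    ext f
    rw [Valuation.mem_valuationSubring_iff, mem_localRing_iff]
  rw [ordGE_one_iff, hequiv.lt_one_iff_lt_one]

variable (P) in
/-- The functions `f` with `v_P(f) ≥ m`, as a vector space over the constants. -/
def ordSubmodule (m : ℤ) : Submodule K F where
  carrier := {f | P.OrdGE m f}
  add_mem' := OrdGE.add
  zero_mem' := ordGE_zero P m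
  smul_mem' a f hf := by
    rw [Algebra.smul_def]
    exact hf.const_mul a

section DedekindModel

variable {B : Type*} [CommRing B] [IsDedekindDomain B] [Algebra B F] [IsFractionRing B F]

theorem finite_setOf_notMem_localRing_of_dedekind (f : F) :
    {P : Place K F | (∀ b : B, algebraMap B F b ∈ P.localRing) ∧ f ∉ P.localRing}.Finite := by
  refine (((HeightOneSpectrum.Support.finite B f).image
    fun v => (v.valuation F).valuationSubring).preimage localRing_injective.injOn).subset ?_
  rintro P ⟨hP, hf⟩
  obtain ⟨v, hv⟩ := exists_valuationSubring_eq hP P.localRing_ne_top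
  refine ⟨v, ?_, hv⟩
  rwa [← hv, Valuation.mem_valuationSubring_iff, not_le] at hf

theorem derivation_mem_localRing (d : Derivation K F F)
    (hP : ∀ b : B, algebraMap B F b ∈ P.localRing)
    (hd : ∀ b : B, d (algebraMap B F b) ∈ P.localRing) {f : F} (hf : f ∈ P.localRing) :
    d f ∈ P.localRing := by
  obtain ⟨v, hv⟩ := exists_valuationSubring_eq hP P.localRing_ne_top
  rw [← hv] at hd hf ⊢
  exact derivation_mem_valuationSubring d v hd hf

theorem fg_map_mkQ_ordSubmodule_zero_of_dedekind [Algebra K B] [IsScalarTower K B F]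
    [Algebra.FiniteType K B] (hP : ∀ b : B, algebraMap B F b ∈ P.localRing) :
    ((P.ordSubmodule 0).map (P.ordSubmodule 1).mkQ).FG := by
  obtain ⟨v, hv⟩ := exists_valuationSubring_eq hP P.localRing_ne_top
  have hfinite : Module.Finite K (B ⧸ v.asIdeal) := by
    have := v.isMaximal
    let := Ideal.Quotient.field v.asIdeal
    exact finite_of_finite_type_of_isJacobsonRing K (B ⧸ v.asIdeal)
  have := Module.Finite.equiv (Submodule.Quotient.restrictScalarsEquiv K v.asIdeal).symm
  let residue : B →ₗ[K] F ⧸ P.ordSubmodule 1 :=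
    (P.ordSubmodule 1).mkQ ∘ₗ (IsScalarTower.toAlgHom K B F).toLinearMap
  have hker : v.asIdeal.restrictScalars K ≤ LinearMap.ker residue := by
    intro b hb
    refine (Submodule.Quotient.mk_eq_zero _).2 ((ordGE_one_iff_valuation_lt_one hv).2 ?_)
    exact (v.valuation_lt_one_iff_mem b).2 hb
  refine Submodule.FG.of_le (Module.Finite.fg_top.map (Submodule.liftQ _ residue hker)) ?_
  rintro _ ⟨f, hf, rfl⟩
  have hf_mem : f ∈ (v.valuation F).valuationSubring := hv ▸ ordGE_zero_iff.1 hf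
  obtain ⟨b, hb⟩ := exists_valuation_sub_algebraMap_lt_one v hf_mem
  rw [Submodule.map_top, Submodule.range_liftQ]
  refine ⟨b, ((Submodule.Quotient.eq _).2 ?_).symm⟩
  exact (ordGE_one_iff_valuation_lt_one hv).2 hb

end DedekindModel

theorem finite_setOf_derivation_notMem_of_isAffineModel {B : Subalgebra K F}
    (hB : IsAffineModel B) (d : Derivation K F F) :
    {P : Place K F | (∀ b : B, algebraMap B F b ∈ P.localRing) ∧
      ∃ f ∈ P.localRing, d f ∉ P.localRing}.Finite := by
  have := hB.isDedekindDomain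
  have := hB.isFractionRing
  obtain ⟨S, hS⟩ := (Subalgebra.fg_iff_finiteType B).2 hB.finiteType
  refine (S.finite_toSet.biUnion fun b _ =>
    finite_setOf_notMem_localRing_of_dedekind (B := B) (d b)).subset ?_
  rintro P ⟨hP, f, hf, hdf⟩
  by_contra hcon
  simp only [Set.mem_iUnion, not_exists] at hcon
  have hgen : ∀ b ∈ S, d b ∈ P.localRing := fun b hb =>
    by_contra fun hdb => hcon b hb ⟨hP, hdb⟩
  have hd : ∀ b ∈ Algebra.adjoin K (S : Set F), d b ∈ P.localRing := by
    intro b hb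
    induction hb using Algebra.adjoin_induction with
    | mem b hb => exact hgen b hb
    | algebraMap a =>
      rw [d.map_algebraMap]
      exact zero_mem _
    | add b c _ _ hb hc =>
      rw [map_add]
      exact add_mem hb hc
    | mul b c hb_mem hc_mem hb hc =>
      rw [d.leibniz]
      exact add_mem (mul_mem (hP ⟨b, hS ▸ hb_mem⟩) hc) (mul_mem (hP ⟨c, hS ▸ hc_mem⟩) hb)
  exact hdf (derivation_mem_localRing d hP (fun b => hd b (hS ▸ b.2)) hf)

variable [PerfectField K] [IsCurveFunctionField K F]

theorem finite_setOf_derivation_notMem (d : Derivation K F F) :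
    {P : Place K F | ∃ f ∈ P.localRing, d f ∉ P.localRing}.Finite := by
  obtain ⟨B, B', hB, hB', hcover⟩ := exists_isAffineModel_cover K F
  refine ((finite_setOf_derivation_notMem_of_isAffineModel hB d).union
    (finite_setOf_derivation_notMem_of_isAffineModel hB' d)).subset fun P hP => ?_
  exact (hcover P.localRing P.algebraMap_mem).imp (⟨·, hP⟩) (⟨·, hP⟩)

theorem fg_map_mkQ_ordSubmodule_zero (P : Place K F) :
    ((P.ordSubmodule 0).map (P.ordSubmodule 1).mkQ).FG := by
  obtain ⟨B, B', hB, hB', hcover⟩ := exists_isAffineModel_cover K F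
  rcases hcover P.localRing P.algebraMap_mem with hP | hP
  · have := hB.isDedekindDomain
    have := hB.isFractionRing
    have := hB.finiteType
    exact fg_map_mkQ_ordSubmodule_zero_of_dedekind hP
  · have := hB'.isDedekindDomain
    have := hB'.isFractionRing
    have := hB'.finiteType
    exact fg_map_mkQ_ordSubmodule_zero_of_dedekind hP

theorem fg_map_mkQ_ordSubmodule (P : Place K F) (m : ℤ) :
    ((P.ordSubmodule m).map (P.ordSubmodule (m + 1)).mkQ).FG := by
  obtain ⟨t, ht⟩ := P.exists_isUniformizer
  let scale : F →ₗ[K] F := LinearMap.mulLeft K (t ^ m)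
  have hscale : P.ordSubmodule 1 ≤ (P.ordSubmodule (m + 1)).comap scale := fun f hf =>
    (ht.ordGE_zpow m).mul hf
  refine Submodule.FG.of_le
    (P.fg_map_mkQ_ordSubmodule_zero.map (Submodule.mapQ _ _ scale hscale)) ?_
  rintro _ ⟨f, hf, rfl⟩
  have hf_div : P.OrdGE 0 (t ^ (-m) * f) := by
    rw [← neg_add_cancel m]
    exact (ht.ordGE_zpow (-m)).mul hf
  refine ⟨_, ⟨t ^ (-m) * f, hf_div, rfl⟩, ?_⟩
  rw [Submodule.mkQ_apply, Submodule.mapQ_apply, LinearMap.mulLeft_apply, ← mul_assoc,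
    ← zpow_add₀ ht.ne_zero, add_neg_cancel, zpow_zero, one_mul, Submodule.mkQ_apply]

theorem isDiscreteValuationRing_of_ne_top {V : ValuationSubring F}
    (hK : ∀ a : K, algebraMap K F a ∈ V) (hne : V ≠ ⊤) : IsDiscreteValuationRing V := by
  obtain ⟨B, B', hB, hB', hcover⟩ := exists_isAffineModel_cover K F
  rcases hcover V hK with hV | hV
  · have := hB.isDedekindDomain
    have := hB.isFractionRing
    obtain ⟨v, rfl⟩ := exists_valuationSubring_eq hV hne
    exact isDiscreteValuationRing_valuationSubring v
  · have := hB'.isDedekindDomain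
    have := hB'.isFractionRing
    obtain ⟨v, rfl⟩ := exists_valuationSubring_eq hV hne
    exact isDiscreteValuationRing_valuationSubring v

/-- The integral closure of `K` in `F` is the intersection of the valuation rings of `F`
containing `K`, and these are `F` itself and the local rings of the places. -/
theorem exists_algebraMap_eq_of_forall_mem {f : F} (hf : ∀ P : Place K F, f ∈ P.localRing) :
    ∃ a : K, algebraMap K F a = f := by
  have hintegral : f ∈ (integralClosure (algebraMap K F).range F).toSubring := by
    rw [← Subring.closure_eq (algebraMap K F).range, ← iInf_valuationSubring_superset,
      Subring.mem_iInf]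
    rintro ⟨V, hV⟩
    have hK : ∀ a : K, algebraMap K F a ∈ V := fun a => hV ⟨a, rfl⟩
    rcases eq_or_ne V ⊤ with rfl | hne
    · exact ValuationSubring.mem_top f
    · exact hf ⟨V, hK, isDiscreteValuationRing_of_ne_top hK hne⟩
  have hle : (integralClosure (algebraMap K F).range F).toSubring ≤
      (integralClosure K F).toSubring := by
    rw [Subring.integralClosure_subring_le_iff]
    rintro _ ⟨a, rfl⟩
    exact isIntegral_algebraMap
  exact IsCurveFunctionField.algebraic_mem f (hle hintegral).isAlgebraic

end Place

section FiniteDimensional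

variable {K F : Type*} [Field K] [Field F] [Algebra K F]

theorem diffSpace_antitone : Antitone (diffSpace : Divisor K F → Submodule K Ω[F⁄K]) :=
  fun _ _ hAB _ hω P => (hω P).mono (hAB P)

variable [PerfectField K] [IsCurveFunctionField K F]

theorem Place.IsUniformizer.diffOrdGE_iff_ordGE_diffCoord {p : ℕ} [Fact p.Prime] [CharP F p]
    {P : Place K F} {t : F} (ht : P.IsUniformizer t) {m : ℤ} {ω : Ω[F⁄K]} :
    P.DiffOrdGE m ω ↔ P.OrdGE m (diffCoord K (p := p) ht.pow_char_ne ω) := by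
  rw [← ht.diffOrdGE_smul_derivation_iff p, diffCoord_apply_smul_derivation]

theorem exists_divisor_ordGE_derivation (d : Derivation K F F) :
    ∃ E : Divisor K F, ∀ P : Place K F, ∃ t, P.IsUniformizer t ∧ P.OrdGE (-E P) (d t) := by
  classical
  choose t ht using fun P : Place K F => P.exists_isUniformizer
  choose n hn using fun P : Place K F => P.exists_ordGE (d (t P))
  let S := (Place.finite_setOf_derivation_notMem d).toFinset
  refine ⟨Finsupp.indicator S fun P _ => -n P, fun P => ⟨t P, ht P, ?_⟩⟩
  rw [Finsupp.indicator_apply]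
  split_ifs with hP
  · rw [neg_neg]
    exact hn P
  · rw [neg_zero, Place.ordGE_zero_iff]
    by_contra hdt
    exact hP ((Set.Finite.mem_toFinset _).2 ⟨t P, (ht P).mem_localRing, hdt⟩)

theorem fg_diffSpace_add_single_iff (p : ℕ) [Fact p.Prime] [CharP F p] (A : Divisor K F)
    (P : Place K F) :
    (diffSpace (A + Finsupp.single P 1)).FG ↔ (diffSpace A).FG := by
  constructor
  · intro hfg
    obtain ⟨t, ht⟩ := P.exists_isUniformizer
    let leadingCoeff : Ω[F⁄K] →ₗ[K] F ⧸ P.ordSubmodule (A P + 1) :=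
      (P.ordSubmodule (A P + 1)).mkQ ∘ₗ
        (diffCoord K (p := p) ht.pow_char_ne).toLinearMap.restrictScalars K
    refine Submodule.fg_of_fg_map_of_fg_inf_ker leadingCoeff ?_ ?_
    · refine Submodule.FG.of_le (P.fg_map_mkQ_ordSubmodule (A P)) ?_
      rintro _ ⟨ω, hω, rfl⟩
      exact ⟨_, (ht.diffOrdGE_iff_ordGE_diffCoord (p := p)).1 (hω P), rfl⟩
    · refine Submodule.FG.of_le hfg ?_
      rintro ω ⟨hω, hker⟩ Q
      rcases eq_or_ne Q P with rfl | hQ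
      · rw [Finsupp.add_apply, Finsupp.single_eq_same, ht.diffOrdGE_iff_ordGE_diffCoord (p := p)]
        exact (Submodule.Quotient.mk_eq_zero _).1 hker
      · rw [Finsupp.add_apply, Finsupp.single_eq_of_ne hQ, add_zero]
        exact hω Q
  · intro hfg
    refine Submodule.FG.of_le hfg (diffSpace_antitone (le_add_of_nonneg_right ?_))
    exact Finsupp.single_nonneg.2 zero_le_one

theorem fg_diffSpace_add_iff (p : ℕ) [Fact p.Prime] [CharP F p] (A E : Divisor K F) :
    (diffSpace (A + E)).FG ↔ (diffSpace A).FG := by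
  induction E using Finsupp.induction_linear generalizing A with
  | zero => rw [add_zero]
  | add E E' hE hE' => rw [← add_assoc, hE', hE]
  | single P n =>
    induction n with
    | zero => rw [Finsupp.single_zero, add_zero]
    | succ n ih =>
      rw [Finsupp.single_add, ← add_assoc, fg_diffSpace_add_single_iff p, ih]
    | pred n ih =>
      rw [← fg_diffSpace_add_single_iff p, add_assoc, ← Finsupp.single_add, sub_add_cancel, ih]

/-- For a suitable divisor `E`, the coordinate of a differential in `Ω(E)` with respect to `dx` has
no poles, hence is constant; and changing a divisor by a single place changes `Ω` by a
finite-dimensional space. -/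
theorem finiteDimensional_diffSpace (p : ℕ) [Fact p.Prime] [CharP F p] (A : Divisor K F) :
    FiniteDimensional K (diffSpace A) := by
  obtain ⟨x, hx⟩ := exists_isSeparating (K := K) (F := F)
  let coord := diffCoord K (p := p) hx.pow_char_ne
  obtain ⟨E, hE⟩ := exists_divisor_ordGE_derivation (coord.toLinearMap.compDer (D K F))
  have hcoord : ∀ ω ∈ diffSpace E, ∀ P : Place K F, coord ω ∈ P.localRing := by
    intro ω hω P
    obtain ⟨t, ht, hdt⟩ := hE P
    obtain ⟨f, hf, rfl⟩ := hω P t ht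
    rw [map_smul, smul_eq_mul, ← Place.ordGE_zero_iff, ← add_neg_cancel (E P)]
    exact hf.mul hdt
  have hle : diffSpace E ≤ Submodule.span K {D K F x} := by
    intro ω hω
    obtain ⟨a, ha⟩ := Place.exists_algebraMap_eq_of_forall_mem (hcoord ω hω)
    refine Submodule.mem_span_singleton.2 ⟨a, ?_⟩
    rw [← algebraMap_smul F a, ha, diffCoord_apply_smul_derivation]
  rw [← Submodule.fg_iff_finiteDimensional, ← add_sub_cancel E A, fg_diffSpace_add_iff p]
  exact Submodule.FG.of_le (Submodule.fg_span_singleton _) hle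

end FiniteDimensional

theorem mem_range_algebraMap_iff_pow_natCard_eq {k K : Type*} [Field k] [Finite k] [Field K]
    [Algebra k K] {c : K} : c ∈ (algebraMap k K).range ↔ c ^ Nat.card k = c := by
  have := Fintype.ofFinite k
  rw [Nat.card_eq_fintype_card]
  constructor
  · rintro ⟨a, rfl⟩
    rw [← map_pow, FiniteField.pow_card]
  · intro hc
    have hsplits : (Polynomial.X ^ Fintype.card k - Polynomial.X : Polynomial k).Splits := by
      rw [Polynomial.splits_iff_card_roots, FiniteField.roots_X_pow_card_sub_X,
        FiniteField.X_pow_card_sub_X_natDegree_eq k Fintype.one_lt_card]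
      rfl
    refine hsplits.mem_range_of_isRoot
      (FiniteField.X_pow_card_sub_X_ne_zero k Fintype.one_lt_card) ?_
    simp only [Polynomial.map_sub, Polynomial.map_pow, Polynomial.map_X, Polynomial.IsRoot,
      Polynomial.eval_sub, Polynomial.eval_pow, Polynomial.eval_X, hc, sub_self]

universe v w in
theorem lift_rank_le_of_ker_le_ker {R X : Type*} {N : Type v} {Q : Type w} [Ring R]
    [AddCommGroup X] [Module R X] [AddCommGroup N] [Module R N] [AddCommGroup Q] [Module R Q]
    {φ : X →ₗ[R] N} {g : X →ₗ[R] Q} (hg : Function.Surjective g)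
    (hker : LinearMap.ker φ ≤ LinearMap.ker g) :
    Cardinal.lift.{v} (Module.rank R Q) ≤ Cardinal.lift.{w} (Module.rank R N) := by
  have hfactor : Function.Surjective ((LinearMap.ker φ).liftQ g hker) := by
    rw [← LinearMap.range_eq_top, Submodule.range_liftQ, LinearMap.range_eq_top.2 hg]
  exact (LinearMap.lift_rank_le_of_surjective
    ((LinearMap.ker φ).liftQ g hker ∘ₗ φ.quotKerEquivRange.symm.toLinearMap)
    (hfactor.comp φ.quotKerEquivRange.symm.surjective)).trans
      (Cardinal.lift_le.2 (Submodule.rank_le _))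

section Codes

variable {K F : Type*} [Field K] [Field F] [Algebra K F] {n : ℕ} {P : Fin n → Place K F}

theorem pointDivisor_apply_self (hP : Function.Injective P) (i : Fin n) :
    pointDivisor P (P i) = 1 := by
  classical
  simp [pointDivisor, Finsupp.finsetSum_apply, Finsupp.single_apply, hP.eq_iff]

theorem pointDivisor_apply_of_notMem {Q : Place K F} (hQ : Q ∉ Set.range P) :
    pointDivisor P Q = 0 := by
  classical
  rw [pointDivisor, Finsupp.finsetSum_apply]
  exact Finset.sum_eq_zero fun i _ => Finsupp.single_eq_of_ne fun h => hQ ⟨i, h.symm⟩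

theorem diffOrdGE_neg_one_of_mem_diffSpace {G : Divisor K F} (hP : Function.Injective P)
    (hG : ∀ i, G (P i) = 0) {ω : Ω[F⁄K]} (hω : ω ∈ diffSpace (G - pointDivisor P)) (i : Fin n) :
    (P i).DiffOrdGE (-1) ω := by
  have hωi := hω (P i)
  rwa [Finsupp.sub_apply, hG i, pointDivisor_apply_self hP, zero_sub] at hωi

variable [PerfectField K] [IsCurveFunctionField K F] {p s : ℕ} [Fact p.Prime] [CharP F p]

theorem cartier_pow_sub_self_mem_diffSpace (hP : Function.Injective P) {G G₁ : Divisor K F}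
    (hG : ∀ i, G (P i) = 0) (hqG₁ : p ^ s • G₁ ≤ G) (hG₁ : G₁ ≤ G) {ω : Ω[F⁄K]} {c : Fin n → K}
    (hω : ω ∈ diffSpace (G - pointDivisor P)) (hres : ∀ i, (P i).HasResidue ω (c i))
    (hc : ∀ i, c i ^ p ^ s = c i) : (cartier K F p ^ s) ω - ω ∈ diffSpace G₁ := by
  intro Q
  by_cases hQ : Q ∈ Set.range P
  · obtain ⟨i, rfl⟩ := hQ
    have hsimple := diffOrdGE_neg_one_of_mem_diffSpace hP hG hω i
    exact ((hres i).diffOrdGE_cartier_pow_sub_self hsimple (hc i)).mono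
      ((hG₁ (P i)).trans (hG i).le)
  · have hωQ : Q.DiffOrdGE (G Q) ω := by
      simpa only [Finsupp.sub_apply, pointDivisor_apply_of_notMem hQ, sub_zero] using hω Q
    have hqG₁Q : (p ^ s : ℤ) * G₁ Q ≤ G Q := by
      simpa only [Finsupp.smul_apply, nsmul_eq_mul, Nat.cast_pow] using hqG₁ Q
    exact (hωQ.mono hqG₁Q).cartier_pow.sub (hωQ.mono (hG₁ Q))

variable {k : Type*} [Field k] [Finite k] [Algebra k K]

theorem cartierCode_le_subfieldSubcode (hq : Nat.card k = p ^ s) (hP : Function.Injective P)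
    {G : Divisor K F} (hG : ∀ i, G (P i) = 0) :
    cartierCode k hq P G ≤ subfieldSubcode k (residueCode P G) := by
  rintro c ⟨ω, hω, hC, hres⟩
  refine ⟨⟨ω, hω, hres⟩, fun i => mem_range_algebraMap_iff_pow_natCard_eq.2 ?_⟩
  rw [hq]
  exact (hres i).pow_eq_self_of_cartier_pow_eq (diffOrdGE_neg_one_of_mem_diffSpace hP hG hω i)
    (isCartierIter_iff.1 hC)

variable [Algebra k F] [IsScalarTower k K F]

variable (K F) in
/-- The operator `𝒞_q = 𝒞 ^ s`, which is linear over the field `k` with `q = p ^ s` elements. -/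
noncomputable def qCartier (hq : Nat.card k = p ^ s) : Ω[F⁄K] →ₗ[k] Ω[F⁄K] where
  toFun ω := (cartier K F p ^ s) ω
  map_add' := map_add _
  map_smul' a ω := by
    have ha : algebraMap k F a ^ p ^ s = algebraMap k F a := by
      rw [← hq]
      exact mem_range_algebraMap_iff_pow_natCard_eq.1 ⟨a, rfl⟩
    rw [RingHom.id_apply, ← algebraMap_smul F a ω, ← algebraMap_smul F a (_ : Ω[F⁄K]),
      ← cartier_pow_apply_pow_smul s, ha]

variable (k) in
/-- The pairs `(ω, res_D ω)` with `ω ∈ Ω(G - D)` whose residues at `D` all lie in `k`. -/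
def residueGraph (P : Fin n → Place K F) (G : Divisor K F) :
    Submodule k (Ω[F⁄K] × (Fin n → K)) where
  carrier := {w | w.1 ∈ diffSpace (G - pointDivisor P) ∧ (∀ i, (P i).HasResidue w.1 (w.2 i)) ∧
    ∀ i, w.2 i ∈ (algebraMap k K).range}
  add_mem' hw hw' := ⟨add_mem hw.1 hw'.1, fun i => (hw.2.1 i).add (hw'.2.1 i),
    fun i => add_mem (hw.2.2 i) (hw'.2.2 i)⟩
  zero_mem' := ⟨zero_mem _, fun _ => Place.HasResidue.zero _, fun _ => zero_mem _⟩
  smul_mem' a w hw := by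
    have hsnd : ∀ i, (a • w).2 i = algebraMap k K a * w.2 i := fun i => Algebra.smul_def _ _
    have hfst : (a • w).1 = algebraMap k K a • w.1 := (algebraMap_smul K a w.1).symm
    refine ⟨hfst ▸ Submodule.smul_mem _ _ hw.1, fun i => ?_, fun i => ?_⟩
    · rw [hsnd, hfst]
      exact (hw.2.1 i).smul _
    · rw [hsnd]
      exact mul_mem ⟨a, rfl⟩ (hw.2.2 i)

theorem qCartier_sub_self_mem_diffSpace (hq : Nat.card k = p ^ s) (hP : Function.Injective P)
    {G G₁ : Divisor K F} (hG : ∀ i, G (P i) = 0) (hqG₁ : Nat.card k • G₁ ≤ G) (hG₁ : G₁ ≤ G)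
    {w : Ω[F⁄K] × (Fin n → K)} (hw : w ∈ residueGraph k P G) :
    qCartier K F hq w.1 - w.1 ∈ diffSpace G₁ := by
  refine cartier_pow_sub_self_mem_diffSpace hP hG (hq ▸ hqG₁) hG₁ hw.1 hw.2.1 fun i => ?_
  rw [← hq]
  exact mem_range_algebraMap_iff_pow_natCard_eq.1 (hw.2.2 i)

end Codes

universe u v in
/-- Apply `lift_rank_le_of_ker_le_ker` to `𝒞_q - 1` with values in `Ω(G₁)` and to the projection
onto the residues. -/
theorem lift_rank_quotient_cartierCode_le {k : Type*} {K : Type u} {F : Type v} [Field k]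
    [Finite k] [Field K] [PerfectField K] [Algebra k K] [Field F] [Algebra K F]
    [IsCurveFunctionField K F] [Algebra k F] [IsScalarTower k K F] {p s n : ℕ} [Fact p.Prime]
    [CharP F p] (hq : Nat.card k = p ^ s) {P : Fin n → Place K F} (hP : Function.Injective P)
    {G G₁ : Divisor K F} (hG : ∀ i, G (P i) = 0) (hqG₁ : Nat.card k • G₁ ≤ G) (hG₁ : G₁ ≤ G) :
    Cardinal.lift.{v} (Module.rank k (subfieldSubcode k (residueCode P G) ⧸
      (cartierCode k hq P G).submoduleOf (subfieldSubcode k (residueCode P G)))) ≤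
      Cardinal.lift.{u} (Module.rank k (diffSpace G₁)) := by
  let φ : residueGraph k P G →ₗ[k] diffSpace G₁ :=
    ((qCartier K F hq - LinearMap.id) ∘ₗ LinearMap.fst k _ _ ∘ₗ
      (residueGraph k P G).subtype).codRestrict ((diffSpace G₁).restrictScalars k)
      fun w => by exact qCartier_sub_self_mem_diffSpace hq hP hG hqG₁ hG₁ w.2
  let residues : residueGraph k P G →ₗ[k] subfieldSubcode k (residueCode P G) :=
    (LinearMap.snd k _ _ ∘ₗ (residueGraph k P G).subtype).codRestrict _
      fun w => ⟨⟨w.1.1, w.2.1, w.2.2.1⟩, w.2.2.2⟩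
  have hresidues : Function.Surjective residues := by
    rintro ⟨c, ⟨ω, hω, hres⟩, hc⟩
    exact ⟨⟨(ω, c), hω, hres, hc⟩, rfl⟩
  refine lift_rank_le_of_ker_le_ker (φ := φ) (g := Submodule.mkQ _ ∘ₗ residues)
    ((Submodule.mkQ_surjective _).comp hresidues) fun w hw => ?_
  refine (Submodule.Quotient.mk_eq_zero _).2 ⟨w.1.1, w.2.1, isCartierIter_iff.2 ?_, w.2.2.1⟩
  exact sub_eq_zero.1 (congrArg Subtype.val (LinearMap.mem_ker.1 hw))

universe u v in
theorem rank_quotient_cartierCode_le {k : Type*} {K : Type u} {F : Type v} [Field k] [Finite k]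
    [Field K] [PerfectField K] [Algebra k K] [Field F] [Algebra K F] [IsCurveFunctionField K F]
    {p s n : ℕ} [Fact p.Prime] [CharP F p] (hq : Nat.card k = p ^ s) {P : Fin n → Place K F}
    (hP : Function.Injective P) {G G₁ : Divisor K F} (hG : ∀ i, G (P i) = 0)
    (hqG₁ : Nat.card k • G₁ ≤ G) (hG₁ : G₁ ≤ G) :
    Module.rank k (subfieldSubcode k (residueCode P G) ⧸
      (cartierCode k hq P G).submoduleOf (subfieldSubcode k (residueCode P G))) ≤
      Module.rank k K * h1 G₁ := by
  let : Algebra k F := ((algebraMap K F).comp (algebraMap k K)).toAlgebra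
  have : IsScalarTower k K F := IsScalarTower.of_algebraMap_eq fun _ => rfl
  have := finiteDimensional_diffSpace p G₁
  have hlift := lift_rank_quotient_cartierCode_le hq hP hG hqG₁ hG₁
  have hrank : Cardinal.lift.{u} (Module.rank k (diffSpace G₁)) =
      Cardinal.lift.{v} (Module.rank k K * h1 G₁) := by
    rw [← lift_rank_mul_lift_rank k K, ← Module.finrank_eq_rank K (diffSpace G₁), h1,
      Cardinal.lift_mul, Cardinal.lift_natCast, Cardinal.lift_natCast]
  rwa [hrank, Cardinal.lift_le] at hlift

end AGCode

theorem mainTheorem3_general {k K F : Type*} [Field k] [Finite k] [Field K] [PerfectField K]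
    [Algebra k K] [Field F] [Algebra K F] [AGCode.IsCurveFunctionField K F] {p s : ℕ}
    [Fact p.Prime] [CharP F p] (hq : Nat.card k = p ^ s) {n : ℕ} (P : Fin n → AGCode.Place K F)
    (hP : Function.Injective P) (G G₁ : AGCode.Divisor K F) (hG : ∀ i, G (P i) = 0)
    (hqG₁ : Nat.card k • G₁ ≤ G) (hG₁ : G₁ ≤ G) :
    FiniteDimensional K (AGCode.diffSpace G₁) ∧
    AGCode.cartierCode k hq P G ≤ AGCode.subfieldSubcode k (AGCode.residueCode P G) ∧
    Module.rank k
        (AGCode.subfieldSubcode k (AGCode.residueCode P G) ⧸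
          (AGCode.cartierCode k hq P G).submoduleOf
            (AGCode.subfieldSubcode k (AGCode.residueCode P G))) ≤
      Module.rank k K * AGCode.h1 G₁ ∧
    (AGCode.h1 G₁ = 0 →
      AGCode.subfieldSubcode k (AGCode.residueCode P G) = AGCode.cartierCode k hq P G) := by
  have hle := AGCode.cartierCode_le_subfieldSubcode hq hP hG
  have hrank := AGCode.rank_quotient_cartierCode_le hq hP hG hqG₁ hG₁
  refine ⟨AGCode.finiteDimensional_diffSpace p G₁, hle, hrank, fun hh1 => ?_⟩
  rw [hh1, Nat.cast_zero, mul_zero, nonpos_iff_eq_zero, rank_zero_iff,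
    Submodule.Quotient.subsingleton_iff, Submodule.submoduleOf_eq_top] at hrank
  exact hrank.antisymm hle

theorem mainTheorem3 {k K F : Type*} [Field k] [Finite k] [Field K] [Algebra k K]
    [FiniteDimensional k K] [Field F] [Algebra K F] [AGCode.IsCurveFunctionField K F]
    {p s ℓ : ℕ} [Fact p.Prime] [CharP F p] (hq : Nat.card k = p ^ s)
    (hℓ : Module.finrank k K = ℓ)
    {n : ℕ} (P : Fin n → AGCode.Place K F) (hP : Function.Injective P)
    (hrat : ∀ i, (P i).IsRational)
    (G G₁ : AGCode.Divisor K F) (hG : ∀ i, G (P i) = 0)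
    (hqG₁ : Nat.card k • G₁ ≤ G) (hG₁ : G₁ ≤ G) :
    FiniteDimensional K (AGCode.diffSpace G₁) ∧
    AGCode.cartierCode k hq P G ≤ AGCode.subfieldSubcode k (AGCode.residueCode P G) ∧
    Module.finrank k
        (AGCode.subfieldSubcode k (AGCode.residueCode P G) ⧸
          (AGCode.cartierCode k hq P G).submoduleOf
            (AGCode.subfieldSubcode k (AGCode.residueCode P G))) ≤
      ℓ * AGCode.h1 G₁ ∧
    (AGCode.h1 G₁ = 0 →
      AGCode.subfieldSubcode k (AGCode.residueCode P G) = AGCode.cartierCode k hq P G) := by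
  have : Finite K := Module.finite_of_finite k
  obtain ⟨hfin, hle, hrank, heq⟩ := mainTheorem3_general hq P hP G G₁ hG hqG₁ hG₁
  refine ⟨hfin, hle, Module.finrank_le_of_rank_le ?_, heq⟩
  rwa [← hℓ, Nat.cast_mul, Module.finrank_eq_rank]
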